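/- **Setting.** Let $\overline M$ be a compact oriented 3-manifold whose boundary is a nonempty union of tori, and let $\tau=\{\Delta_1,\dots,\Delta_n\}$ be an ideal triangulation of $M=\overline M\smallsetminus\partial\overline M$: truncated tetrahedra glued in pairs along their hexagonal faces, so that the truncation triangles (cusp triangles) tile $\partial\overline M$. Assign one real variable (angle) to each pair of opposite edges of each tetrahedron. A vector $\theta\in\mathbb R^{3n}$ is a *generalized angle structure* if the three angles of each tetrahedron sum to $\pi$ and the angles around each edge of $M$ sum to $2\pi$; it is *positive* if all angles are $>0$, and *taut* if all angles are $0$ (thin) or $\pi$ (wide). A taut angle structure is *veering* if for every vertex $v$ of the tiling of $\partial\overline M$, either all triangles with a thin angle at $v$ have their wide angle immediately before $v$ in counterclockwise order ($v$ is blue), or all have it immediately after $v$ ($v$ is red). The two ends of an edge of $M$ have the same color, which is the color of the edge. A tetrahedron is a *hinge* if its two edges with wide angles have different colors. An edge of the tiling of $\partial\overline M$ is a *ladderpole segment* if its ends have the same color. A *normal curve* $\gamma\subset\partial\overline M$ is an embedded oriented closed curve transverse to the edges of the tiling that enters and leaves each triangle through different edges. Its *leading–trailing deformation* is $D^\gamma=\sum_e(\varepsilon_{j_e}-\varepsilon_{j'_e})\in\mathbb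 R^{3n}$, summed over the crossings $e$ of $\gamma$ with edges of the tiling, where $j_e$ (resp. $j'_e$) is the angle opposite the crossed edge in the triangle entered (resp. left) and $\varepsilon_j$ is the $j$-th basis vector. For an edge $\epsilon$ of $M$, $D^\epsilon$ is the deformation $D^{\gamma}$ for a clockwise loop $\gamma$ around an end of $\epsilon$ (both ends give the same vector). Put $D=\sum_{\epsilon\text{ blue}}D^\epsilon-\sum_{\epsilon\text{ red}}D^\epsilon$. **Theorem 1.1.** Let $\theta$ be a veering taut angle structure on $\tau$. Then $\theta$ can be deformed to a positive angle structure: there is a continuous path $(\theta^s)_{0\le s\le1}$ of generalized angle structures with $\theta^0=\theta$ and $\theta^s$ positive for all $0<s\le 1$. Moreover, consider the following properties of a generalized angle structure: (1) every hinge has positive angles; (2) every non-hinge tetrahedron has non-negative angles; (3) every angle of a cusp triangle that equals $0$ is opposite a ladderpole segment. Then: (a) for every $t\in(0,\pi/4)$, $\theta+tD$ is a generalized angle structure satisfying (1)–(3); (b) if $\theta'$ is any generalized angle structure that satisfies (1)–(3) and has at least one zero angle, then there is a homotopically trivial normal curve $\gamma\subset\partial\overline M$, passing through each cusp triangle at most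 once, such that for all sufficiently small $t>0$ the vector $\theta'+tD^\gamma$ is a generalized angle structure satisfying (1)–(3) with strictly fewer zero angles than $\theta'$. -/

import Mathlib

open Filter Topology

noncomputable section

namespace Veering

/-- An oriented ideal triangulation with tetrahedra indexed by `ι`. The tips of each tetrahedron are
`0, 1, 2, 3` (in positive orientation), and its face `f` is the one opposite the tip `f`. The face
`f` of `i` is glued to a face of `nbr i f`; the tip `v ≠ f` of that face goes to the tip
`glue i f v`, and `glue i f f` is the number of the target face. Gluings reverse the orientation
(so that the orientations of the tetrahedra fit together), and faces are glued in pairs.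

Removing the tips gives an oriented 3-manifold `M`: since no face is glued to itself and
orientations fit, no edge is glued to itself backwards. The truncated tips form a closed oriented
surface, the boundary of the compactification of `M`. As soon as angles satisfying the
equations of `IsGeneralizedAngleStructure` exist, each component of that surface has Euler
characteristic zero (combinatorial Gauss-Bonnet), so it is a torus: this need not be required
separately. Connectedness of `M` is not required either. -/
structure IdealTriangulation (ι : Type*) where
  nbr : ι → Fin 4 → ι
  glue : ι → Fin 4 → Equiv.Perm (Fin 4)
  sign_glue : ∀ i f, Equiv.Perm.sign (glue i f) = -1
  nbr_nbr : ∀ i f, nbr (nbr i f) (glue i f f) = i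
  glue_glue : ∀ i f, glue (nbr i f) (glue i f f) = (glue i f)⁻¹
  not_self : ∀ i f, (nbr i f, glue i f f) ≠ (i, f)

/-- A flag `(i, p)` is an ordering `p 0, p 1, p 2, p 3` of the tips of the tetrahedron `i`.
It is read in the cusp triangle `(i, p 0)` that truncates the tip `p 0`. That triangle has three
corners, one on each edge from `p 0` to another tip; the corner on the edge `{p 0, w}` is called `w`,
and the side of the triangle opposite the corner `w` (it lies in the face `w` of `i`) is also called
`w`. The flag is based at the corner `p 1`, and this corner lies between the sides `p 2` and `p 3`.
It stands as well for the normal arc that enters the triangle through the side `p 3`, cuts off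
the corner `p 1`, and leaves through the side `p 2`.

For an even `p`, the corners `p 1, p 2, p 3` are in counterclockwise order. So even flags
are the same thing as corners of cusp triangles. -/
abbrev Flag (ι : Type*) := ι × Equiv.Perm (Fin 4)

/-- An even flag. -/
def Flag.IsEven {ι : Type*} (x : Flag ι) : Prop := Equiv.Perm.sign x.2 = 1

/-- The flag at the next corner `p 2` of the same cusp triangle: `(p 0, p 2, p 3, p 1)`. -/
def Flag.turn {ι : Type*} (x : Flag ι) : Flag ι :=
  (x.1, x.2 * (Equiv.swap 1 2 * Equiv.swap 2 3))

/-- The flag based at the opposite edge of the tetrahedron: `(p 2, p 3, p 0, p 1)`. -/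
def Flag.opp {ι : Type*} (x : Flag ι) : Flag ι :=
  (x.1, x.2 * (Equiv.swap 0 2 * Equiv.swap 1 3))

/-- The same cusp triangle and the same entered side `p 3`, with `p 1` and `p 2` exchanged. -/
def Flag.mirror {ι : Type*} (x : Flag ι) : Flag ι :=
  (x.1, x.2 * Equiv.swap 1 2)

/-- The three pairs of opposite edges of a tetrahedron: the pair to which the edge `{v, w}` belongs.
(The values on the diagonal are irrelevant.) -/
def oppositePair : Fin 4 → Fin 4 → Fin 3 :=
  ![![0, 0, 1, 2], ![0, 0, 2, 1], ![1, 2, 0, 0], ![2, 1, 0, 0]]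

/-- One real variable for each pair of opposite edges of each tetrahedron. -/
abbrev AngleVector (ι : Type*) := ι × Fin 3 → ℝ

/-- The index of the angle at the corner `p k` of the cusp triangle `(i, p 0)`, `k = 1, 2, 3`. -/
def Flag.angle {ι : Type*} (x : Flag ι) (k : Fin 4) : ι × Fin 3 :=
  (x.1, oppositePair (x.2 0) (x.2 k))

namespace IdealTriangulation

variable {ι : Type*} (T : IdealTriangulation ι)

/-- Leave the cusp triangle of a flag through its side `p 2`, and take the corner of the next
triangle that sits at the same vertex of the cusp triangulation. For an even flag this is the next
corner in counterclockwise order around that vertex, for an odd flag the next one in clockwise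
order. -/
def rot : Equiv.Perm (Flag ι) where
  toFun x := (T.nbr x.1 (x.2 2), T.glue x.1 (x.2 2) * x.2 * Equiv.swap 2 3)
  invFun x := (T.nbr x.1 (x.2 3), T.glue x.1 (x.2 3) * x.2 * Equiv.swap 2 3)
  left_inv x := by
    obtain ⟨i, p⟩ := x
    ext1
    · simp [T.nbr_nbr]
    · simp [T.glue_glue, mul_assoc]
  right_inv x := by
    obtain ⟨i, p⟩ := x
    ext1
    · simp [T.nbr_nbr]
    · simp [T.glue_glue, mul_assoc]

variable [Fintype ι]

open Classical in
/-- All corners around the vertex of the cusp triangulation at which the flag `x` is based, as flags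
of the same parity as `x`. They correspond to the angles that surround the edge of `M` that
ends at this vertex. -/
def vertexLink (x : Flag ι) : Finset (Flag ι) :=
  Finset.univ.filter fun y => T.rot.SameCycle x y

/-- Generalized angle structures: the angles of each tetrahedron sum to `π`, and the angles around
each edge sum to `2π`. -/
structure IsGeneralizedAngleStructure (θ : AngleVector ι) : Prop where
  tetrahedron : ∀ i, ∑ q, θ (i, q) = Real.pi
  edge : ∀ x : Flag ι, ∑ y ∈ T.vertexLink x, θ (y.angle 1) = 2 * Real.pi

structure IsTaut (θ : AngleVector ι) : Prop extends T.IsGeneralizedAngleStructure θ where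
  zero_or_pi : ∀ j, θ j = 0 ∨ θ j = Real.pi

structure IsPositive (θ : AngleVector ι) : Prop extends T.IsGeneralizedAngleStructure θ where
  pos : ∀ j, 0 < θ j

/-- For an even flag `x`, the vertex at which `x` is based is left-veering: each triangle of its fans
(having a thin angle at the vertex) has its wide angle immediately before the vertex in
counterclockwise order. The edge of `M` ending at such a vertex is colored blue. -/
def LeftVeering (θ : AngleVector ι) (x : Flag ι) : Prop :=
  ∀ y ∈ T.vertexLink x, θ (y.angle 1) = 0 → θ (y.angle 3) = Real.pi

/-- The same with the wide angles immediately after the vertex: right-veering, or red. -/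
def RightVeering (θ : AngleVector ι) (x : Flag ι) : Prop :=
  ∀ y ∈ T.vertexLink x, θ (y.angle 1) = 0 → θ (y.angle 2) = Real.pi

/-- Veering taut angle structures. -/
structure IsVeering (θ : AngleVector ι) : Prop extends T.IsTaut θ where
  veering : ∀ x : Flag ι, x.IsEven → T.LeftVeering θ x ∨ T.RightVeering θ x

/-- A tetrahedron is a hinge if its two diagonals (the edges with wide angles) have different
colors. -/
def IsHinge (θ : AngleVector ι) (i : ι) : Prop :=
  ∃ x : Flag ι, x.IsEven ∧ x.1 = i ∧ θ (x.angle 1) = Real.pi ∧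
    T.LeftVeering θ x ∧ T.RightVeering θ x.opp

/-- The side opposite the corner of the even flag `x` is a ladderpole segment: its two ends
have the same color. -/
def OppositeLadderpole (θ : AngleVector ι) (x : Flag ι) : Prop :=
  (T.LeftVeering θ x.turn ∧ T.LeftVeering θ x.turn.turn) ∨
    (T.RightVeering θ x.turn ∧ T.RightVeering θ x.turn.turn)

end IdealTriangulation

open Classical in
/-- The contribution of a normal arc to a leading-trailing deformation: the angle opposite the side
through which the arc enters its triangle goes up, and the angle opposite the side through
which it leaves goes down. -/
def arcDeformation {ι : Type*} (x : Flag ι) : AngleVector ι :=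
  Pi.single (x.angle 3) 1 - Pi.single (x.angle 2) 1

/-- The leading-trailing deformation of the closed normal curve that consists of the given arcs. -/
def curveDeformation {ι : Type*} (γ : List (Flag ι)) : AngleVector ι :=
  (γ.map arcDeformation).sum

namespace IdealTriangulation

variable {ι : Type*} (T : IdealTriangulation ι)

section
variable [Fintype ι]

/-- The leading-trailing deformation of a clockwise loop around the vertex at which the even
flag `x` is based. (The arcs of `vertexLink x` form the counterclockwise loop.) -/
def clockwiseDeformation (x : Flag ι) : AngleVector ι :=
  -∑ y ∈ T.vertexLink x, arcDeformation y

open Classical in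
/-- The vertices of the cusp triangulation, each given as the set of corners around it. -/
def cuspVertices : Finset (Finset (Flag ι)) :=
  (Finset.univ.filter Flag.IsEven).image T.vertexLink

open Classical in
/-- A corner at a given vertex of the cusp triangulation (all choices are equivalent). -/
def cornerAt (V : T.cuspVertices) : Flag ι :=
  (Finset.mem_image.1 V.2).choose

open Classical in
/-- The sum of the clockwise deformations over all blue edges of `M`, minus the sum over all red
edges. Each edge has two ends, which have the same color and the same clockwise deformation, so
this is half of the corresponding sum over all vertices of the cusp triangulation. -/
def blueMinusRed (θ : AngleVector ι) : AngleVector ι :=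
  (1 / 2 : ℝ) • ∑ V : T.cuspVertices,
    if T.LeftVeering θ (T.cornerAt V) then T.clockwiseDeformation (T.cornerAt V)
    else -T.clockwiseDeformation (T.cornerAt V)

/-- With hinges and ladderpoles defined by the veering structure `θ`: in `θ'`, hinges have
positive angles, other tetrahedra have non-negative angles, and all zeros are opposite ladderpole
segments. -/
structure IsPartiallyRescued (θ θ' : AngleVector ι) : Prop
    extends T.IsGeneralizedAngleStructure θ' where
  hinge_pos : ∀ i, T.IsHinge θ i → ∀ q, 0 < θ' (i, q)
  nonhinge_nonneg : ∀ i, ¬ T.IsHinge θ i → ∀ q, 0 ≤ θ' (i, q)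
  zero_opposite : ∀ x : Flag ι, x.IsEven → θ' (x.angle 1) = 0 → T.OppositeLadderpole θ x

end

/-- The normal arc `y` begins where the normal arc `x` ends. -/
def Follows (x y : Flag ι) : Prop := y = T.rot x ∨ y = (T.rot x).mirror

/-- A closed normal curve that passes through each cusp triangle at most once (in particular, an
embedded one), given as the cyclic list of its arcs. -/
structure IsSimpleNormalCurve (γ : List (Flag ι)) : Prop where
  ne_nil : γ ≠ []
  chain : Cycle.Chain T.Follows (γ : Cycle (Flag ι))
  nodup : (γ.map fun x => (x.1, x.2 0)).Nodup

/-- A way to cross a side of a cusp triangle: the triangle `(tet, tip)` is left through its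
side `side`. -/
structure Crossing (ι : Type*) where
  tet : ι
  tip : Fin 4
  side : Fin 4
  ne : side ≠ tip

/-- The crossing at the end of a normal arc. -/
def exit (x : Flag ι) : Crossing ι := ⟨x.1, x.2 0, x.2 2, by simp⟩

/-- The triangle reached by a crossing. -/
def target (d : Crossing ι) : ι × Fin 4 := (T.nbr d.tet d.side, T.glue d.tet d.side d.tip)

/-- The crossing of the same side in the other direction. -/
def back (d : Crossing ι) : Crossing ι :=
  ⟨T.nbr d.tet d.side, T.glue d.tet d.side d.tip, T.glue d.tet d.side d.side, by
    simpa using d.ne⟩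

/-- `T.IsPath A l B`: starting in the cusp triangle `A`, one can make the crossings `l` one after the
other, and ends in the cusp triangle `B`. -/
def IsPath (A : ι × Fin 4) : List (Crossing ι) → ι × Fin 4 → Prop
  | [], B => A = B
  | d :: l, B => (d.tet, d.tip) = A ∧ IsPath (T.target d) l B

/-- Closed paths whose insertion is an elementary homotopy on the boundary surface: going across
a side and back, or going around a vertex until the path closes up. -/
inductive IsElementaryLoop : List (Crossing ι) → Prop
  | backtrack (d : Crossing ι) : IsElementaryLoop [d, T.back d]
  | vertex (x : Flag ι) (n : ℕ) (hn : (T.rot ^ n) x = x) :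
      IsElementaryLoop ((List.range n).map fun k => exit ((T.rot ^ k) x))

/-- `q` arises from `p` by insertion of an elementary loop; both are closed paths at `A`. -/
def HomotopyStep (A : ι × Fin 4) (p q : List (Crossing ι)) : Prop :=
  T.IsPath A p A ∧ T.IsPath A q A ∧
    ∃ p₁ p₂ e, T.IsElementaryLoop e ∧ p = p₁ ++ p₂ ∧ q = p₁ ++ e ++ p₂

/-- The closed path `l` at `A` is homotopically trivial on the boundary surface. -/
def IsNullHomotopic (A : ι × Fin 4) (l : List (Crossing ι)) : Prop :=
  T.IsPath A l A ∧ Relation.EqvGen (T.HomotopyStep A) l []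

/-- The closed normal curve `γ` is homotopically trivial. (Its first arc lies in the cusp
triangle that is reached by the crossing at the end of its last arc.) -/
def IsTrivialCurve (γ : List (Flag ι)) : Prop :=
  ∃ A, T.IsNullHomotopic A (γ.map exit)

end IdealTriangulation

end Veering

end

noncomputable section
namespace Veering

open Equiv (swap Perm)

variable {ι : Type*}

/-! Every leading-trailing deformation of a closed normal curve preserves the angle equations. Pair
an arc with a weight on flags that is constant around each vertex: the result is a term for the side
left minus a term for the side entered (`sum_mul_arcDeformation`), so it telescopes to zero along a
closed curve. Taking the indicator of a vertex gives the edge equation there.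

In each cusp triangle the two thin corners have opposite colors and the wide corner has either one.
The triangle's share of `blueMinusRed` moves angle from the wide corner to the thin corner whose
opposite side has ends of different colors. Summed over the four triangles of a tetrahedron
(`blueMinusRed_apply`), a hinge receives `2t` at both thin angles, while any other tetrahedron
receives `4t` at one, and its other thin angle stays zero, opposite ladderpole segments. The wide
angle drops by `4t`, whence the bound `π/4`.

For the remaining zeros, follow a ladderpole. A zero lies outside the hinges, so the triangle next
to it around its vertex again faces the same ladderpole (`isLadder_rot`). Not all angles at a vertex
vanish, so zeros come in finite runs. A shortest run that begins opposite a nonzero angle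
(`exists_run`) has matching triangles on both sides of the ladderpole. The curve around this strip
(`runCurve`) leaves triangles only opposite nonzero angles and enters the first one opposite a zero
(`exists_curve`). It bounds a disk, swept out by pushing over one ladderpole vertex after another.
Iterating removes all zeros, and the segment from `θ` to the positive structure so obtained is the
required path. -/

/-- Relabel the positions of a flag. -/
def Flag.act (x : Flag ι) (q : Perm (Fin 4)) : Flag ι := (x.1, x.2 * q)

/-! ### Relabelled flags and the angle indices they see -/

namespace Flag

@[simp] theorem act_act (x : Flag ι) (q r : Perm (Fin 4)) : (x.act q).act r = x.act (q * r) := by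
  simp [act, mul_assoc]

@[simp] theorem act_one (x : Flag ι) : x.act 1 = x := by simp [act]

@[simp] theorem act_fst (x : Flag ι) (q : Perm (Fin 4)) : (x.act q).1 = x.1 := rfl

theorem act_injective (q : Perm (Fin 4)) : Function.Injective fun x : Flag ι => x.act q := by
  intro x y h
  simpa using congrArg (fun z : Flag ι => z.act q⁻¹) h

theorem exists_act_eq {x y : Flag ι} (h : x.1 = y.1) : ∃ q, y = x.act q :=
  ⟨x.2⁻¹ * y.2, by ext1 <;> simp [act, h]⟩

theorem turn_eq (x : Flag ι) : x.turn = x.act (swap 1 2 * swap 2 3) := rfl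
theorem opp_eq (x : Flag ι) : x.opp = x.act (swap 0 2 * swap 1 3) := rfl
theorem mirror_eq (x : Flag ι) : x.mirror = x.act (swap 1 2) := rfl

theorem sign_act (x : Flag ι) (q : Perm (Fin 4)) :
    Perm.sign (x.act q).2 = Perm.sign x.2 * Perm.sign q := by simp [act]

theorem isEven_act {x : Flag ι} {q : Perm (Fin 4)} (hq : Perm.sign q = 1) :
    (x.act q).IsEven ↔ x.IsEven := by simp [IsEven, sign_act, hq]

theorem isEven_act_odd {x : Flag ι} {q : Perm (Fin 4)} (hq : Perm.sign q = -1) :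
    (x.act q).IsEven ↔ ¬ x.IsEven := by
  rcases Int.units_eq_one_or (Perm.sign x.2) with h | h <;> simp [IsEven, sign_act, hq, h]

end Flag

/-- The edge from the tip `0` that lies in the same pair of opposite edges as `{a, b}`, given by its
other end. -/
def pairPartner : Fin 4 → Fin 4 → Fin 4 :=
  ![![0, 1, 2, 3], ![1, 0, 3, 2], ![2, 3, 0, 1], ![3, 2, 1, 0]]

/-- Permutations of the tips preserve the partition of the six edges into opposite pairs. Through
`Flag.angle_act`, comparing angles of relabelled flags becomes a finite computation on positions. -/
theorem oppositePair_perm : ∀ (p : Perm (Fin 4)) (a b : Fin 4), a ≠ b →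
    oppositePair (p a) (p b) = oppositePair (p 0) (p (pairPartner a b)) := by
  decide +kernel

theorem Flag.angle_act (x : Flag ι) (q : Perm (Fin 4)) (k l : Fin 4)
    (h : q 0 ≠ q k ∧ pairPartner (q 0) (q k) = l := by decide) :
    (x.act q).angle k = x.angle l := by
  simp only [Flag.angle, Flag.act, Perm.coe_mul, Function.comp_apply]
  rw [oppositePair_perm _ _ _ h.1, h.2]

theorem oppositePair_cases : ∀ p : Perm (Fin 4),
    (oppositePair (p 0) (p 1), oppositePair (p 0) (p 2), oppositePair (p 0) (p 3)) ∈
      ([(0, 1, 2), (0, 2, 1), (1, 0, 2), (1, 2, 0), (2, 0, 1), (2, 1, 0)] :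
        List (Fin 3 × Fin 3 × Fin 3)) := by
  decide

theorem Flag.sum_angle (x : Flag ι) (v : AngleVector ι) :
    ∑ q, v (x.1, q) = v (x.angle 1) + v (x.angle 2) + v (x.angle 3) := by
  have h := oppositePair_cases x.2
  simp only [List.mem_cons, Prod.mk.injEq, List.not_mem_nil, or_false] at h
  simp only [Flag.angle, Fin.sum_univ_three]
  rcases h with h | h | h | h | h | h <;> rw [h.1, h.2.1, h.2.2] <;> ring

theorem exists_oppositePair : ∀ (q : Fin 3) (a : Fin 4), ∃ p : Perm (Fin 4),
    Perm.sign p = 1 ∧ p 0 = a ∧ oppositePair (p 0) (p 1) = q := by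
  decide

theorem Flag.exists_even_angle (j : ι × Fin 3) : ∃ x : Flag ι, x.IsEven ∧ x.angle 1 = j := by
  obtain ⟨p, hp, -, h⟩ := exists_oppositePair j.2 0
  exact ⟨(j.1, p), hp, by ext1 <;> simp [Flag.angle, h]⟩

theorem oppositePair_injective : ∀ (p : Perm (Fin 4)) (k l : Fin 4), k ≠ 0 → l ≠ 0 →
    oppositePair (p 0) (p k) = oppositePair (p 0) (p l) → k = l := by
  decide

theorem Flag.angle_eq_angle_iff (x : Flag ι) {k l : Fin 4} (hk : k ≠ 0) (hl : l ≠ 0) :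
    x.angle k = x.angle l ↔ k = l :=
  ⟨fun h => oppositePair_injective x.2 k l hk hl (congrArg Prod.snd h), fun h => h ▸ rfl⟩

/-! ### Identities for moving between adjacent cusp triangles -/

namespace IdealTriangulation

variable (T : IdealTriangulation ι)

/-- The flag on the other side of the face `p 2`, with the same positions. -/
def cross (x : Flag ι) : Flag ι := (T.nbr x.1 (x.2 2), T.glue x.1 (x.2 2) * x.2)

@[simp] theorem cross_cross (x : Flag ι) : T.cross (T.cross x) = x := by
  ext1 <;> simp [cross, T.nbr_nbr, T.glue_glue]

theorem cross_act (x : Flag ι) (q : Perm (Fin 4)) (hq : q 2 = 2) :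
    T.cross (x.act q) = (T.cross x).act q := by
  ext1 <;> simp [cross, Flag.act, hq, mul_assoc]

theorem rot_eq (x : Flag ι) : T.rot x = (T.cross x).act (swap 2 3) := by
  ext1 <;> simp [cross, Flag.act, rot]

theorem rot_symm_eq (x : Flag ι) : T.rot.symm x = T.cross (x.act (swap 2 3)) := by
  rw [Equiv.symm_apply_eq, rot_eq, cross_cross]
  simp

theorem rot_inv_eq (x : Flag ι) : T.rot⁻¹ x = T.cross (x.act (swap 2 3)) := T.rot_symm_eq x

theorem rot_act_swap01 (x : Flag ι) : T.rot (x.act (swap 0 1)) = (T.rot x).act (swap 0 1) := by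
  rw [rot_eq, rot_eq, T.cross_act x (swap 0 1) (by decide), Flag.act_act, Flag.act_act]
  congr 1; decide

theorem rot_act_swap23 (x : Flag ι) :
    T.rot (x.act (swap 2 3)) = (T.rot⁻¹ x).act (swap 2 3) := by
  rw [rot_inv_eq, rot_eq]

/-- Rotating about the far end of the side just crossed leads back to the first triangle. Hence
`(T.rot x).turn` and `x.turn.turn` sit at one vertex and share its color. -/
theorem rot_turn_rot (x : Flag ι) : T.rot (T.rot x).turn = x.turn.turn := by
  have : (T.rot x).turn = T.cross (x.act (swap 1 3)) := by
    rw [T.cross_act x (swap 1 3) (by decide), rot_eq, Flag.turn_eq, Flag.act_act]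
    congr 1; decide
  rw [this, rot_eq, cross_cross, Flag.act_act, Flag.turn_eq, Flag.turn_eq, Flag.act_act]
  congr 1; decide

/-- The flag on the other side of the side opposite to the base corner, with its ends exchanged. -/
def across (x : Flag ι) : Flag ι := (T.cross (x.act (swap 1 2))).act (swap 1 2 * swap 2 3)

theorem across_across (x : Flag ι) : T.across (T.across x) = x := by
  rw [across, across, Flag.act_act,
    show swap (1 : Fin 4) 2 * swap 2 3 * swap 1 2 = swap 1 3 by decide,
    T.cross_act _ (swap 1 3) (by decide), cross_cross, Flag.act_act, Flag.act_act]
  convert Flag.act_one x using 2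
  decide

theorem across_ne (x : Flag ι) : T.across x ≠ x := by
  intro h
  have h1 := congrArg Prod.fst h
  have h2 := congrArg (fun z : Flag ι => z.2 1) h
  refine T.not_self x.1 (x.2 1) ?_
  simp [across, cross, Flag.act] at h1 h2
  rw [Prod.mk.injEq]
  refine ⟨h1, ?_⟩
  rwa [show swap (2 : Fin 4) 3 1 = 1 by decide] at h2

theorem rot_turn_turn (x : Flag ι) : T.rot x.turn.turn = (T.across x).turn := by
  rw [rot_eq, across, Flag.turn_eq, Flag.turn_eq, Flag.turn_eq, Flag.act_act, Flag.act_act,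
    show (swap (1 : Fin 4) 2 * swap 2 3) * (swap 1 2 * swap 2 3) = swap 1 2 * swap 1 3 by decide,
    ← Flag.act_act,
    T.cross_act _ (swap 1 3) (by decide), Flag.act_act]
  congr 1; decide

theorem rot_mirror (x : Flag ι) : T.rot x.mirror = (T.across x).act (swap 1 3) := by
  rw [rot_eq, across, Flag.mirror_eq, Flag.act_act]
  congr 1; decide

theorem rot_act_swap13 (x : Flag ι) : T.rot (x.act (swap 1 3)) = (T.rot x).mirror := by
  rw [rot_eq, rot_eq, T.cross_act x (swap 1 3) (by decide), Flag.mirror_eq, Flag.act_act, Flag.act_act]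
  congr 1; decide

/-- The relabelled flag `(p 3, p 2, p 1, p 0)` reads the same angle at the opposite edge, in another
cusp triangle. There the side opposite the base corner lies in the face `p 2`, the one that `rot`
crosses. -/
theorem across_act (x : Flag ι) :
    T.across (x.act (swap 1 2 * swap 0 3)) = (T.rot x).opp := by
  rw [across, rot_eq, Flag.act_act,
    show swap (1 : Fin 4) 2 * swap 0 3 * swap 1 2 = swap 0 3 by decide,
    T.cross_act x (swap 0 3) (by decide), Flag.opp_eq, Flag.act_act, Flag.act_act]
  congr 1; decide

end IdealTriangulation

/-! ### Vertex links and their colors -/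

namespace IdealTriangulation

variable {T : IdealTriangulation ι}

/-- Relabelling as a permutation of the flags. -/
def actPerm (q : Perm (Fin 4)) : Perm (Flag ι) where
  toFun x := x.act q
  invFun x := x.act q⁻¹
  left_inv x := by simp
  right_inv x := by simp

theorem sameCycle_act_swap01 {x y : Flag ι} :
    T.rot.SameCycle (x.act (swap 0 1)) (y.act (swap 0 1)) ↔ T.rot.SameCycle x y := by
  have h : (actPerm (swap 0 1))⁻¹ * T.rot * ((actPerm (swap 0 1) : Perm (Flag ι))⁻¹)⁻¹ =
      T.rot := by
    rw [inv_inv, mul_assoc, inv_mul_eq_iff_eq_mul]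
    ext1 z
    exact T.rot_act_swap01 z
  have := Perm.sameCycle_conj (f := T.rot) (g := (actPerm (swap 0 1))⁻¹) (x := x) (y := y)
  rw [h, inv_inv] at this
  exact this.symm

theorem sameCycle_act_swap23 {x y : Flag ι} :
    T.rot.SameCycle (x.act (swap 2 3)) (y.act (swap 2 3)) ↔ T.rot.SameCycle x y := by
  have h : (actPerm (swap 2 3))⁻¹ * T.rot * ((actPerm (swap 2 3) : Perm (Flag ι))⁻¹)⁻¹ =
      T.rot⁻¹ := by
    rw [inv_inv, mul_assoc, inv_mul_eq_iff_eq_mul]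
    ext1 z
    exact T.rot_act_swap23 z
  have := Perm.sameCycle_conj (f := T.rot) (g := (actPerm (swap 2 3))⁻¹) (x := x) (y := y)
  rw [h, inv_inv, Perm.sameCycle_inv] at this
  exact this.symm

theorem sameCycle_rot (x : Flag ι) : T.rot.SameCycle x (T.rot x) :=
  (Perm.sameCycle_apply_right).2 (Perm.SameCycle.refl _ _)

theorem sameCycle_rot_pow (x : Flag ι) (n : ℕ) : T.rot.SameCycle x ((T.rot ^ n) x) :=
  ⟨n, by simp⟩

variable [Fintype ι]

@[simp] theorem mem_vertexLink {x y : Flag ι} : y ∈ T.vertexLink x ↔ T.rot.SameCycle x y := by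
  simp [vertexLink]

theorem mem_vertexLink_self (x : Flag ι) : x ∈ T.vertexLink x :=
  mem_vertexLink.2 (Perm.SameCycle.refl _ _)

theorem vertexLink_eq {x y : Flag ι} (h : T.rot.SameCycle x y) :
    T.vertexLink x = T.vertexLink y := by
  ext z
  simp only [mem_vertexLink]
  exact ⟨fun hz => h.symm.trans hz, fun hz => h.trans hz⟩

variable {θ : AngleVector ι}

theorem leftVeering_congr {x y : Flag ι} (h : T.rot.SameCycle x y) :
    T.LeftVeering θ x ↔ T.LeftVeering θ y := by
  simp only [LeftVeering, vertexLink_eq h]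

theorem rightVeering_congr {x y : Flag ι} (h : T.rot.SameCycle x y) :
    T.RightVeering θ x ↔ T.RightVeering θ y := by
  simp only [RightVeering, vertexLink_eq h]

/-- Looking from the other end of the edge (`swap 0 1`) and reflecting (`swap 2 3`) each exchange
the angles 2 and 3, hence left and right. With flags of both parities, one argument then serves both
colors. -/
theorem leftVeering_act_swap01 {x : Flag ι} :
    T.LeftVeering θ (x.act (swap 0 1)) ↔ T.RightVeering θ x := by
  simp only [LeftVeering, RightVeering, mem_vertexLink]
  constructor <;> intro h y hy h0
  · have := h (y.act (swap 0 1)) (sameCycle_act_swap01.2 hy)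
    rw [y.angle_act _ 1 1, y.angle_act _ 3 2] at this
    exact this h0
  · have := h (y.act (swap 0 1)) (sameCycle_act_swap01.1 (by simpa using hy))
    rw [y.angle_act _ 1 1, y.angle_act _ 2 3] at this
    exact this h0

theorem leftVeering_act_swap23 {x : Flag ι} :
    T.LeftVeering θ (x.act (swap 2 3)) ↔ T.RightVeering θ x := by
  simp only [LeftVeering, RightVeering, mem_vertexLink]
  constructor <;> intro h y hy h0
  · have := h (y.act (swap 2 3)) (sameCycle_act_swap23.2 hy)
    rw [y.angle_act _ 1 1, y.angle_act _ 3 2] at this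
    exact this h0
  · have := h (y.act (swap 2 3)) (sameCycle_act_swap23.1 (by simpa using hy))
    rw [y.angle_act _ 1 1, y.angle_act _ 2 3] at this
    exact this h0

theorem rightVeering_act_swap01 {x : Flag ι} :
    T.RightVeering θ (x.act (swap 0 1)) ↔ T.LeftVeering θ x := by
  rw [← leftVeering_act_swap01, Flag.act_act, Equiv.swap_mul_self, Flag.act_one]

theorem rightVeering_act_swap23 {x : Flag ι} :
    T.RightVeering θ (x.act (swap 2 3)) ↔ T.LeftVeering θ x := by
  rw [← leftVeering_act_swap23, Flag.act_act, Equiv.swap_mul_self, Flag.act_one]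

namespace IsTaut

variable (h : T.IsTaut θ)
include h

theorem sum_angle (x : Flag ι) : θ (x.angle 1) + θ (x.angle 2) + θ (x.angle 3) = Real.pi := by
  rw [← x.sum_angle, h.tetrahedron]

theorem cases_angle (x : Flag ι) :
    (θ (x.angle 1) = Real.pi ∧ θ (x.angle 2) = 0 ∧ θ (x.angle 3) = 0) ∨
    (θ (x.angle 1) = 0 ∧ θ (x.angle 2) = Real.pi ∧ θ (x.angle 3) = 0) ∨
    (θ (x.angle 1) = 0 ∧ θ (x.angle 2) = 0 ∧ θ (x.angle 3) = Real.pi) := by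
  have := h.sum_angle x
  have hp := Real.pi_pos
  rcases h.zero_or_pi (x.angle 1) with h1 | h1 <;> rcases h.zero_or_pi (x.angle 2) with h2 | h2 <;>
    rcases h.zero_or_pi (x.angle 3) with h3 | h3 <;> rw [h1, h2, h3] at this <;>
    first
    | (exfalso; linarith)
    | simp [h1, h2, h3]

theorem not_leftVeering {x : Flag ι} (h2 : θ (x.angle 2) = Real.pi) : ¬ T.LeftVeering θ x := by
  intro hl
  have hp := Real.pi_pos
  have h3 := hl x (mem_vertexLink_self x)
  rcases h.cases_angle x with c | c | c
  · linarith [c.2.1]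
  · linarith [c.2.2, h3 c.1]
  · linarith [c.2.1]

theorem not_rightVeering {x : Flag ι} (h3 : θ (x.angle 3) = Real.pi) : ¬ T.RightVeering θ x := by
  intro hr
  rw [← leftVeering_act_swap23] at hr
  refine h.not_leftVeering ?_ hr
  rwa [x.angle_act _ 2 3]

end IsTaut

namespace IsVeering

variable (h : T.IsVeering θ)
include h

theorem leftVeering_or_rightVeering (x : Flag ι) : T.LeftVeering θ x ∨ T.RightVeering θ x := by
  by_cases hx : x.IsEven
  · exact h.veering x hx
  · have := h.veering (x.act (swap 2 3)) ((Flag.isEven_act_odd (by decide)).2 hx)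
    rwa [leftVeering_act_swap23, rightVeering_act_swap23, or_comm] at this

theorem rightVeering {x : Flag ι} (h2 : θ (x.angle 2) = Real.pi) : T.RightVeering θ x :=
  (h.leftVeering_or_rightVeering x).resolve_left (h.not_leftVeering h2)

theorem leftVeering {x : Flag ι} (h3 : θ (x.angle 3) = Real.pi) : T.LeftVeering θ x :=
  (h.leftVeering_or_rightVeering x).resolve_right (h.not_rightVeering h3)

/-- Otherwise the far end of the side between the two wide corners would be colored in opposite ways
by the two triangles. -/
theorem angle_rot_ne_pi {x : Flag ι} (hx : θ (x.angle 1) = Real.pi) :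
    θ ((T.rot x).angle 1) ≠ Real.pi := by
  intro hy
  have h1 : θ (x.turn.turn.angle 2) = Real.pi := by
    rwa [Flag.turn_eq, Flag.turn_eq, Flag.act_act, x.angle_act _ 2 1]
  have h2 : θ ((T.rot x).turn.angle 3) = Real.pi := by
    rwa [Flag.turn_eq, Flag.angle_act _ _ 3 1]
  refine h.not_leftVeering h1 ((leftVeering_congr ?_).1 (h.leftVeering h2))
  rw [← rot_turn_rot]
  exact sameCycle_rot _

/-- A thin angle at the vertex would put two wide angles in its triangle, so all angles there would
be wide, including two consecutive ones. -/
theorem not_leftVeering_and_rightVeering {x : Flag ι} (hl : T.LeftVeering θ x) :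
    ¬ T.RightVeering θ x := by
  intro hr
  have hp := Real.pi_pos
  have key : ∀ y ∈ T.vertexLink x, θ (y.angle 1) = Real.pi := by
    intro y hy
    refine (h.zero_or_pi _).resolve_left fun h0 => ?_
    have h2 := hr y hy h0
    have h3 := hl y hy h0
    have := h.sum_angle y
    linarith
  exact h.angle_rot_ne_pi (key x (mem_vertexLink_self x)) (key _ (by simpa using sameCycle_rot x))

theorem rightVeering_iff {x : Flag ι} : T.RightVeering θ x ↔ ¬ T.LeftVeering θ x :=
  ⟨fun hr hl => h.not_leftVeering_and_rightVeering hl hr,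
    fun hl => (h.leftVeering_or_rightVeering x).resolve_left hl⟩

theorem sum_link_le (x : Flag ι) (s : Finset (Flag ι)) (hs : s ⊆ T.vertexLink x) :
    ∑ y ∈ s, θ (y.angle 1) ≤ 2 * Real.pi := by
  rw [← h.edge x]
  refine Finset.sum_le_sum_of_subset_of_nonneg hs fun y _ _ => ?_
  rcases h.zero_or_pi (y.angle 1) with h0 | h0 <;> rw [h0]
  exact Real.pi_pos.le

/-- There are only two wide angles at a vertex. -/
theorem eq_of_wide {x y z : Flag ι} (hy : T.rot.SameCycle x y) (hz : T.rot.SameCycle x z)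
    (hx' : θ (x.angle 1) = Real.pi) (hy' : θ (y.angle 1) = Real.pi)
    (hz' : θ (z.angle 1) = Real.pi) (hxy : x ≠ y) (hxz : x ≠ z) : y = z := by
  classical
  by_contra hyz
  have := h.sum_link_le x {x, y, z} (by
    intro w hw
    simp only [Finset.mem_insert, Finset.mem_singleton] at hw
    rcases hw with rfl | rfl | rfl <;> simp [*, Perm.SameCycle.refl])
  rw [Finset.sum_insert (by simp [*]), Finset.sum_insert (by simp [*]), Finset.sum_singleton,
    hx', hy', hz'] at this
  linarith [Real.pi_pos]

/-- A vertex with at most two corners could reach `2π` only with two consecutive wide angles. -/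
theorem rot_rot_ne (x : Flag ι) : T.rot (T.rot x) ≠ x := by
  intro hx
  classical
  have key : ∀ n : ℕ, (T.rot ^ n) x = x ∨ (T.rot ^ n) x = T.rot x := by
    intro n
    induction n with
    | zero => simp
    | succ n ih =>
      rw [pow_succ', Perm.mul_apply]
      rcases ih with ih | ih <;> rw [ih]
      · exact Or.inr rfl
      · exact Or.inl hx
  have hsub : T.vertexLink x ⊆ {x, T.rot x} := by
    intro y hy
    obtain ⟨n, rfl⟩ := (mem_vertexLink.1 hy).exists_nat_pow_eq
    simpa using key n
  have h0 : ∀ y : Flag ι, 0 ≤ θ (y.angle 1) := by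
    intro y
    rcases h.zero_or_pi (y.angle 1) with h0 | h0 <;> rw [h0]
    exact Real.pi_pos.le
  have h1 := h.edge x
  have h2 := Finset.sum_le_sum_of_subset_of_nonneg (f := fun y : Flag ι => θ (y.angle 1)) hsub
    fun y _ _ => h0 y
  have hr := h.angle_rot_ne_pi (x := x)
  have hp := Real.pi_pos
  by_cases hxr : x = T.rot x
  · rw [← hxr] at h2 hr
    rw [Finset.pair_eq_singleton, Finset.sum_singleton, h1] at h2
    rcases h.zero_or_pi (x.angle 1) with h3 | h3 <;> linarith
  · rw [Finset.sum_pair hxr, h1] at h2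
    rcases h.zero_or_pi (x.angle 1) with h3 | h3
    · rcases h.zero_or_pi ((T.rot x).angle 1) with h4 | h4 <;> linarith
    · have h4 := (h.zero_or_pi _).resolve_right (hr h3)
      linarith

end IsVeering
end IdealTriangulation

/-! ### Leading-trailing deformations are tangent to the angle equations -/

theorem Flag.sum_eq_sum_act {M : Type*} [AddCommMonoid M] [Fintype ι] [DecidableEq ι]
    (x : Flag ι) (f : Flag ι → M) :
    ∑ y, (if y.1 = x.1 then f y else 0) = ∑ q, f (x.act q) := by
  rw [Fintype.sum_prod_type]
  rw [Fintype.sum_eq_single x.1 fun i hi => Finset.sum_eq_zero fun p _ => if_neg hi]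
  simp only [if_true, Flag.act]
  exact (Equiv.sum_comp (Equiv.mulLeft x.2) fun p => f (x.1, p)).symm

theorem arcDeformation_apply (x : Flag ι) (j : ι × Fin 3) [DecidableEq ι] :
    arcDeformation x j = (if j = x.angle 3 then 1 else 0) - (if j = x.angle 2 then 1 else 0) := by
  simp only [arcDeformation, Pi.sub_apply, Pi.single_apply]
  congr

namespace IdealTriangulation

variable (T : IdealTriangulation ι)

section edgeSum

variable (χ : Flag ι → ℝ)

/-- The sum of `χ` over the flags based at the edge of a given flag, in a given tetrahedron. -/
def edgeSum (x : Flag ι) : ℝ :=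
  χ x + χ (x.act (swap 0 1)) + (χ (x.act (swap 2 3)) + χ (x.act (swap 0 1 * swap 2 3)))

variable {χ}

theorem edgeSum_act_swap01 (x : Flag ι) : edgeSum χ (x.act (swap 0 1)) = edgeSum χ x := by
  simp only [edgeSum, Flag.act_act, Equiv.swap_mul_self, Flag.act_one, ← mul_assoc, one_mul]
  ring

theorem edgeSum_act_swap23 (x : Flag ι) : edgeSum χ (x.act (swap 2 3)) = edgeSum χ x := by
  simp only [edgeSum, Flag.act_act, Equiv.swap_mul_self, Flag.act_one]
  rw [show swap (2 : Fin 4) 3 * swap 0 1 = swap 0 1 * swap 2 3 by decide,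
    show swap (2 : Fin 4) 3 * (swap 0 1 * swap 2 3) = swap 0 1 by decide]
  ring

variable {T}

theorem edgeSum_rot (h : ∀ x, χ (T.rot x) = χ x) (x : Flag ι) :
    edgeSum χ (T.rot x) = edgeSum χ x := by
  have h' : ∀ x, χ (T.rot⁻¹ x) = χ x := fun x => by
    rw [← h]; exact congrArg χ (T.rot.apply_symm_apply x)
  have h23 : ∀ x, χ ((T.rot x).act (swap 2 3)) = χ (x.act (swap 2 3)) := by
    intro x
    rw [← h, rot_act_swap23]
    exact congrArg (fun y : Flag ι => χ (y.act _)) (T.rot.symm_apply_apply x)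
  have h01 := h (x.act (swap 0 1))
  have h0123 := h23 (x.act (swap 0 1))
  rw [rot_act_swap01] at h01 h0123
  simp only [Flag.act_act] at h0123
  rw [edgeSum, edgeSum, h, h23, h01, h0123]

theorem edgeSum_cross (h : ∀ x, χ (T.rot x) = χ x) (x : Flag ι) :
    edgeSum χ (T.cross x) = edgeSum χ x := by
  rw [← edgeSum_rot h x, rot_eq, edgeSum_act_swap23]

variable (χ)

/-- An alternating sum over the edges of the face that contains the side `p 3`. -/
def sideSum (x : Flag ι) : ℝ :=
  edgeSum χ x + edgeSum χ (x.act (swap 1 2)) - edgeSum χ (x.act (swap 0 2))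

variable {χ}

/-- The mirror arc enters through the same side, so the boundary term does not depend on which way a
curve turns afterwards. -/
theorem sideSum_mirror (x : Flag ι) : sideSum χ x.mirror = sideSum χ x := by
  rw [Flag.mirror_eq, sideSum, sideSum, Flag.act_act, Flag.act_act, Equiv.swap_mul_self,
    Flag.act_one, show swap (1 : Fin 4) 2 * swap 0 2 = swap 0 2 * swap 0 1 by decide,
    ← Flag.act_act, edgeSum_act_swap01]
  ring

theorem sideSum_rot (h : ∀ x, χ (T.rot x) = χ x) (x : Flag ι) :
    sideSum χ (T.rot x) =
      edgeSum χ x + edgeSum χ (x.act (swap 1 3)) - edgeSum χ (x.act (swap 0 3)) := by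
  rw [sideSum, edgeSum_rot h, rot_eq, Flag.act_act, Flag.act_act,
    show swap (2 : Fin 4) 3 * swap 1 2 = swap 1 3 * swap 2 3 by decide,
    show swap (2 : Fin 4) 3 * swap 0 2 = swap 0 3 * swap 2 3 by decide,
    ← Flag.act_act, ← Flag.act_act, edgeSum_act_swap23, edgeSum_act_swap23,
    ← T.cross_act _ _ (by decide), ← T.cross_act _ _ (by decide), edgeSum_cross h,
    edgeSum_cross h]

theorem sum_perm_angle [Fintype ι] [DecidableEq ι] (x : Flag ι) :
    (∑ q, χ (x.act q) * (if (x.act q).angle 1 = x.angle 2 then 1 else 0) =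
      edgeSum χ (x.act (swap 1 2)) + edgeSum χ (x.act (swap 0 3))) ∧
    (∑ q, χ (x.act q) * (if (x.act q).angle 1 = x.angle 3 then 1 else 0) =
      edgeSum χ (x.act (swap 1 3)) + edgeSum χ (x.act (swap 0 2))) := by
  have key : ∀ q : Perm (Fin 4), (x.act q).angle 1 = x.angle (pairPartner (q 0) (q 1)) :=
    fun q => x.angle_act q 1 _ ⟨by simp, rfl⟩
  have hne : ∀ q : Perm (Fin 4), pairPartner (q 0) (q 1) ≠ 0 := by decide
  have h2 : (Finset.univ.filter fun q : Perm (Fin 4) => pairPartner (q 0) (q 1) = 2) =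
      {swap 1 2, swap 1 2 * swap 0 1, swap 1 2 * swap 2 3, swap 1 2 * (swap 0 1 * swap 2 3),
        swap 0 3, swap 0 3 * swap 0 1, swap 0 3 * swap 2 3, swap 0 3 * (swap 0 1 * swap 2 3)} := by
    decide +kernel
  have h3 : (Finset.univ.filter fun q : Perm (Fin 4) => pairPartner (q 0) (q 1) = 3) =
      {swap 1 3, swap 1 3 * swap 0 1, swap 1 3 * swap 2 3, swap 1 3 * (swap 0 1 * swap 2 3),
        swap 0 2, swap 0 2 * swap 0 1, swap 0 2 * swap 2 3, swap 0 2 * (swap 0 1 * swap 2 3)} := by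
    decide +kernel
  simp only [mul_ite, mul_one, mul_zero, key]
  constructor
  · simp only [x.angle_eq_angle_iff (hne _) (show (2 : Fin 4) ≠ 0 by decide)]
    rw [← Finset.sum_filter, h2]
    repeat rw [Finset.sum_insert (by decide)]
    simp only [Finset.sum_singleton, edgeSum, Flag.act_act]
    ring
  · simp only [x.angle_eq_angle_iff (hne _) (show (3 : Fin 4) ≠ 0 by decide)]
    rw [← Finset.sum_filter, h3]
    repeat rw [Finset.sum_insert (by decide)]
    simp only [Finset.sum_singleton, edgeSum, Flag.act_act]
    ring

/-- The raised and the lowered angle each belong to two opposite edges. The resulting four edge sums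
regroup by the faces containing the sides left and entered: the common edge `{p 0, p 1}` cancels in
the difference. -/
theorem sum_mul_arcDeformation [Fintype ι] (h : ∀ x, χ (T.rot x) = χ x) (x : Flag ι) :
    ∑ y : Flag ι, χ y * arcDeformation x (y.angle 1) = sideSum χ (T.rot x) - sideSum χ x := by
  classical
  have h1 : ∀ y : Flag ι, χ y * arcDeformation x (y.angle 1) =
      if y.1 = x.1 then χ y * (if y.angle 1 = x.angle 3 then 1 else 0) -
        χ y * (if y.angle 1 = x.angle 2 then 1 else 0) else 0 := by
    intro y
    rw [arcDeformation_apply]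
    split_ifs with hy h3 h2 h2 h2 h3 h2 <;> simp_all [Flag.angle]
  rw [Finset.sum_congr rfl fun y _ => h1 y, x.sum_eq_sum_act, Finset.sum_sub_distrib,
    (sum_perm_angle x).1, (sum_perm_angle x).2, sideSum_rot h, sideSum]
  ring

end edgeSum

theorem sum_arcDeformation (x : Flag ι) (i : ι) : ∑ q, arcDeformation x (i, q) = 0 := by
  classical
  by_cases hi : i = x.1
  · subst hi
    rw [x.sum_angle]
    simp only [arcDeformation_apply, x.angle_eq_angle_iff (show (1 : Fin 4) ≠ 0 by decide)
      (show (2 : Fin 4) ≠ 0 by decide), x.angle_eq_angle_iff (show (1 : Fin 4) ≠ 0 by decide)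
      (show (3 : Fin 4) ≠ 0 by decide), x.angle_eq_angle_iff (show (2 : Fin 4) ≠ 0 by decide)
      (show (3 : Fin 4) ≠ 0 by decide), x.angle_eq_angle_iff (show (3 : Fin 4) ≠ 0 by decide)
      (show (2 : Fin 4) ≠ 0 by decide)]
    simp
  · refine Finset.sum_eq_zero fun q _ => ?_
    simp [arcDeformation_apply, Flag.angle, hi]

variable {T} in
theorem sum_sideSum_of_isChain {χ : Flag ι → ℝ} (b : Flag ι) :
    ∀ (l : List (Flag ι)) (a : Flag ι), List.IsChain T.Follows (a :: (l ++ [b])) →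
      ((a :: l).map fun x => sideSum χ (T.rot x)).sum = ((l ++ [b]).map (sideSum χ)).sum := by
  have key : ∀ {x y : Flag ι}, T.Follows x y → sideSum χ (T.rot x) = sideSum χ y := by
    rintro x y (rfl | rfl)
    · rfl
    · rw [sideSum_mirror]
  intro l
  induction l with
  | nil =>
    intro a h
    simp only [List.nil_append, List.isChain_cons_cons] at h
    simp [key h.1]
  | cons c l ih =>
    intro a h
    simp only [List.cons_append, List.isChain_cons_cons] at h
    have := ih c h.2
    rw [List.map_cons, List.sum_cons, this, key h.1]
    simp

variable [Fintype ι]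

/-- Infinitesimal deformations of generalized angle structures. -/
structure IsTangent (v : AngleVector ι) : Prop where
  tetrahedron : ∀ i, ∑ q, v (i, q) = 0
  edge : ∀ x : Flag ι, ∑ y ∈ T.vertexLink x, v (y.angle 1) = 0

variable {T}

theorem IsTangent.add {v w : AngleVector ι} (hv : T.IsTangent v) (hw : T.IsTangent w) :
    T.IsTangent (v + w) where
  tetrahedron i := by simp [Finset.sum_add_distrib, hv.tetrahedron, hw.tetrahedron]
  edge x := by simp [Finset.sum_add_distrib, hv.edge, hw.edge]

theorem IsTangent.smul {v : AngleVector ι} (hv : T.IsTangent v) (t : ℝ) :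
    T.IsTangent (t • v) where
  tetrahedron i := by simp [← Finset.mul_sum, hv.tetrahedron]
  edge x := by simp [← Finset.mul_sum, hv.edge]

theorem IsTangent.neg {v : AngleVector ι} (hv : T.IsTangent v) : T.IsTangent (-v) := by
  simpa using hv.smul (-1)

theorem isTangent_zero : T.IsTangent (0 : AngleVector ι) := ⟨by simp, by simp⟩

theorem isTangent_sum {κ : Type*} (s : Finset κ) (f : κ → AngleVector ι)
    (h : ∀ k ∈ s, T.IsTangent (f k)) : T.IsTangent (∑ k ∈ s, f k) :=
  Finset.sum_induction f T.IsTangent (fun _ _ => .add) isTangent_zero h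

theorem IsGeneralizedAngleStructure.add {θ v : AngleVector ι}
    (hθ : T.IsGeneralizedAngleStructure θ) (hv : T.IsTangent v) :
    T.IsGeneralizedAngleStructure (θ + v) where
  tetrahedron i := by simp [Finset.sum_add_distrib, hv.tetrahedron, hθ.tetrahedron]
  edge x := by simp [Finset.sum_add_distrib, hv.edge, hθ.edge]

open Classical in
/-- The indicator function of the corners at a vertex. -/
def linkIndicator (T : IdealTriangulation ι) (x : Flag ι) : Flag ι → ℝ :=
  fun y => if T.rot.SameCycle x y then 1 else 0

theorem linkIndicator_rot (x y : Flag ι) :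
    T.linkIndicator x (T.rot y) = T.linkIndicator x y :=
  by classical exact if_congr Perm.sameCycle_apply_right rfl rfl

theorem sum_vertexLink (x : Flag ι) (v : AngleVector ι) :
    ∑ y ∈ T.vertexLink x, v (y.angle 1) = ∑ y, T.linkIndicator x y * v (y.angle 1) := by
  simp [vertexLink, Finset.sum_filter, linkIndicator]

theorem isTangent_of_sideSum {κ : Type*} (s : Finset κ) (f : κ → Flag ι)
    (h : ∀ χ : Flag ι → ℝ, (∀ x, χ (T.rot x) = χ x) →
      ∑ k ∈ s, (sideSum χ (T.rot (f k)) - sideSum χ (f k)) = 0) :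
    T.IsTangent (∑ k ∈ s, arcDeformation (f k)) where
  tetrahedron i := by
    simp only [Finset.sum_apply]
    rw [Finset.sum_comm]
    exact Finset.sum_eq_zero fun k _ => sum_arcDeformation _ _
  edge x := by
    rw [sum_vertexLink]
    simp only [Finset.sum_apply, Finset.mul_sum]
    rw [Finset.sum_comm, ← h (T.linkIndicator x) (linkIndicator_rot x)]
    exact Finset.sum_congr rfl fun k _ => sum_mul_arcDeformation (linkIndicator_rot x) _

theorem isTangent_clockwiseDeformation (x : Flag ι) :
    T.IsTangent (T.clockwiseDeformation x) := by
  refine IsTangent.neg (isTangent_of_sideSum _ _ fun χ _ => ?_)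
  rw [Finset.sum_sub_distrib, sub_eq_zero]
  refine Finset.sum_bij (fun y _ => T.rot y) ?_ ?_ ?_ ?_
  · intro y hy
    simpa using hy
  · intro y _ z _ hyz
    exact T.rot.injective hyz
  · intro y hy
    exact ⟨T.rot⁻¹ y, by simpa using hy, by simp⟩
  · intro y _
    rfl

theorem isTangent_blueMinusRed (θ : AngleVector ι) : T.IsTangent (T.blueMinusRed θ) := by
  refine IsTangent.smul (isTangent_sum _ _ fun V _ => ?_) _
  split_ifs
  · exact isTangent_clockwiseDeformation _
  · exact (isTangent_clockwiseDeformation _).neg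

theorem isTangent_curveDeformation {γ : List (Flag ι)} (hγ : T.IsSimpleNormalCurve γ) :
    T.IsTangent (curveDeformation γ) := by
  have h : curveDeformation γ = ∑ k : Fin γ.length, arcDeformation γ[k.1] :=
    (Fin.sum_univ_fun_getElem γ arcDeformation).symm
  rw [h]
  refine isTangent_of_sideSum _ _ fun χ _ => ?_
  have h2 := fun f : Flag ι → ℝ => Fin.sum_univ_fun_getElem γ f
  rw [Finset.sum_sub_distrib, h2 fun x => sideSum χ (T.rot x), h2, sub_eq_zero]
  have hc := hγ.chain
  cases γ with
  | nil => rfl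
  | cons a l =>
    rw [Cycle.chain_coe_cons] at hc
    rw [sum_sideSum_of_isChain a l a hc]
    simp [add_comm]

/-- A tangent direction that pushes no zero angle down and at least one up removes zeros. -/
theorem IsPartiallyRescued.eventually_add_smul {θ θ' v : AngleVector ι}
    (h : T.IsPartiallyRescued θ θ') (hv : T.IsTangent v) (h0 : ∀ j, θ' j = 0 → 0 ≤ v j)
    (h1 : ∃ j, θ' j = 0 ∧ 0 < v j) :
    ∀ᶠ t in 𝓝[>] (0 : ℝ), T.IsPartiallyRescued θ (θ' + t • v) ∧
      {j | (θ' + t • v) j = 0}.ncard < {j | θ' j = 0}.ncard := by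
  have hnn : ∀ j, 0 ≤ θ' j := by
    rintro ⟨i, q⟩
    by_cases hi : T.IsHinge θ i
    · exact (h.hinge_pos i hi q).le
    · exact h.nonhinge_nonneg i hi q
  have hev : ∀ᶠ t in 𝓝[>] (0 : ℝ), ∀ j, θ' j ≠ 0 → 0 < (θ' + t • v) j := by
    rw [eventually_all]
    intro j
    by_cases hj : θ' j = 0
    · exact Eventually.of_forall fun t hj' => absurd hj hj'
    have hcont : Continuous fun t : ℝ => (θ' + t • v) j := by
      simp only [Pi.add_apply, Pi.smul_apply, smul_eq_mul]
      fun_prop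
    have hpos : 0 < (θ' + (0 : ℝ) • v) j := by simpa using (hnn j).lt_of_ne' hj
    have := (hcont.tendsto 0).eventually (lt_mem_nhds hpos)
    exact (this.filter_mono nhdsWithin_le_nhds).mono fun t ht _ => ht
  filter_upwards [hev, self_mem_nhdsWithin] with t ht htpos
  have htpos' : (0 : ℝ) < t := htpos
  have hnn' : ∀ j, 0 ≤ (θ' + t • v) j := by
    intro j
    by_cases hj : θ' j = 0
    · have := mul_nonneg htpos'.le (h0 j hj)
      simpa [hj] using this
    · exact (ht j hj).le
  have hzero : ∀ j, (θ' + t • v) j = 0 → θ' j = 0 := by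
    intro j hj
    by_contra hne
    exact (ht j hne).ne' hj
  refine ⟨⟨h.add (hv.smul t), fun i hi q => ht _ (h.hinge_pos i hi q).ne', fun i _ q => hnn' _,
    fun x hx hx0 => h.zero_opposite x hx (hzero _ hx0)⟩, ?_⟩
  refine Set.ncard_lt_ncard ⟨fun j hj => hzero j hj, fun hsub => ?_⟩ (Set.toFinite _)
  obtain ⟨j, hj, hvj⟩ := h1
  have h2 : (θ' + t • v) j = 0 := hsub hj
  have := mul_pos htpos' hvj
  simp [hj] at h2
  rcases h2 with h2 | h2 <;> linarith

end IdealTriangulation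

/-! ### Triangles along a ladderpole -/

namespace IdealTriangulation

variable {T : IdealTriangulation ι} [Fintype ι] {θ : AngleVector ι}

/-- The wide angle of the triangle is at the corner `p 2`, and the side opposite to the corner `p 1`
is a ladderpole segment. -/
def IsLadder (T : IdealTriangulation ι) (θ : AngleVector ι) (x : Flag ι) : Prop :=
  θ (x.angle 2) = Real.pi ∧ T.LeftVeering θ x.turn

namespace IsVeering

variable (h : T.IsVeering θ)
include h

theorem leftVeering_turn_turn {x : Flag ι} (hx : θ (x.angle 2) = Real.pi) :
    T.LeftVeering θ x.turn.turn := by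
  refine h.leftVeering ?_
  rwa [Flag.turn_eq, Flag.turn_eq, Flag.act_act, x.angle_act _ 3 2]

theorem isLadder_across {x : Flag ι} (hx : T.IsLadder θ x) : T.IsLadder θ (T.across x) := by
  have hturn : T.LeftVeering θ (T.across x).turn := by
    rw [← rot_turn_turn, ← leftVeering_congr (sameCycle_rot _)]
    exact h.leftVeering_turn_turn hx.1
  refine ⟨?_, hturn⟩
  have hturn2 : T.LeftVeering θ (T.across x).turn.turn := by
    rw [leftVeering_congr (sameCycle_rot _), rot_turn_turn, across_across]
    exact hx.2
  -- Both ends of the shared side are left-veering, which excludes every other position of the wide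
  -- angle.
  rcases h.cases_angle (T.across x) with c | c | c
  · refine absurd hturn2 (h.not_leftVeering ?_)
    rw [Flag.turn_eq, Flag.turn_eq, Flag.act_act, Flag.angle_act _ _ 2 1]
    exact c.1
  · exact c.2.1
  · refine absurd hturn (h.not_leftVeering ?_)
    rw [Flag.turn_eq, Flag.angle_act _ _ 2 3]
    exact c.2.2

/-- The color of the common vertex leaves two positions for the wide angle of the next triangle. If
it were at the base corner, it would force the second diagonal of the tetrahedron of `x` to be
right-veering, while the first is left-veering: a hinge. -/
theorem isLadder_rot {x : Flag ι} (hx : T.IsLadder θ x) (hh : ¬ T.IsHinge θ x.1) :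
    T.IsLadder θ (T.rot x) := by
  have hR : T.RightVeering θ (T.rot x) :=
    (rightVeering_congr (sameCycle_rot x)).1 (h.rightVeering hx.1)
  rcases h.cases_angle (T.rot x) with c | c | c
  · refine absurd ?_ hh
    have hopp : T.RightVeering θ x.turn.opp := by
      have : T.rot ((T.rot x).act (swap 2 3 * swap 0 3)) = x.turn.opp := by
        rw [rot_eq, rot_eq, Flag.act_act,
          show swap (2 : Fin 4) 3 * (swap 2 3 * swap 0 3) = swap 0 3 by decide,
          T.cross_act _ _ (by decide), cross_cross, Flag.turn_eq, Flag.opp_eq, Flag.act_act,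
          Flag.act_act]
        congr 1; decide
      rw [← this, ← rightVeering_congr (sameCycle_rot _)]
      refine h.rightVeering ?_
      rw [Flag.angle_act _ _ 2 1]
      exact c.1
    by_cases hev : x.IsEven
    · refine ⟨x.turn, (Flag.isEven_act (by decide)).2 hev, rfl, ?_, hx.2, hopp⟩
      rw [Flag.turn_eq, Flag.angle_act _ _ 1 2]
      exact hx.1
    · refine ⟨x.turn.opp.act (swap 2 3), ?_, rfl, ?_, leftVeering_act_swap23.2 hopp, ?_⟩
      · rw [Flag.opp_eq, Flag.turn_eq, Flag.act_act, Flag.act_act]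
        exact (Flag.isEven_act_odd (by decide)).2 hev
      · rw [Flag.opp_eq, Flag.turn_eq, Flag.act_act, Flag.act_act, Flag.angle_act _ _ 1 2]
        exact hx.1
      · have : (x.turn.opp.act (swap 2 3)).opp = x.turn.act (swap 0 1) := by
          rw [Flag.opp_eq, Flag.opp_eq, Flag.act_act, Flag.act_act]
          congr 1; decide
        rw [this, rightVeering_act_swap01]
        exact hx.2
  · refine ⟨c.2.1, ?_⟩
    rw [leftVeering_congr (sameCycle_rot _), rot_turn_rot]
    exact h.leftVeering_turn_turn hx.1
  · exact absurd hR (h.not_rightVeering c.2.2)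

theorem angle_one_eq_zero {x : Flag ι} (hx : θ (x.angle 2) = Real.pi) : θ (x.angle 1) = 0 := by
  have := Real.pi_pos
  rcases h.cases_angle x with c | c | c <;> linarith [c.1, c.2.1]

/-- Across a rung and across a ladderpole segment in either order. -/
theorem rot_across_rot {x : Flag ι} (hx : T.IsLadder θ x) (hr : T.IsLadder θ (T.rot x))
    (hy : T.IsLadder θ (T.rot (T.across (T.rot x)))) :
    T.rot (T.across (T.rot x)) = T.across x := by
  have hv : T.rot (T.rot (T.rot x).mirror) = (T.rot (T.across (T.rot x))).mirror := by
    rw [rot_mirror, rot_act_swap13]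
  have hu : T.rot (T.rot (T.across x).mirror) = (T.rot x).mirror := by
    rw [rot_mirror, across_across, rot_act_swap13]
  have hw : ∀ y : Flag ι, T.IsLadder θ y → θ (y.mirror.angle 1) = Real.pi := by
    intro y hy
    rw [Flag.mirror_eq, Flag.angle_act _ _ 1 2]
    exact hy.1
  -- At the ladderpole vertex between the two segments, all three mirrored flags have wide corners.
  -- The first differs from the other two by `rot_rot_ne`, and there is room for only two.
  refine Flag.act_injective (swap 1 2) (h.eq_of_wide (x := (T.rot x).mirror) ?_ ?_ (hw _ hr)
    (hw _ hy) (hw _ (h.isLadder_across hx)) ?_ ?_)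
  · show T.rot.SameCycle _ (T.rot (T.across (T.rot x))).mirror
    rw [← hv]
    exact (sameCycle_rot _).trans (sameCycle_rot _)
  · nth_rewrite 1 [← hu]
    exact ((sameCycle_rot _).trans (sameCycle_rot _)).symm
  · intro he
    exact h.rot_rot_ne (T.rot x).mirror (hv.trans he.symm)
  · intro he
    exact h.rot_rot_ne (T.across x).mirror (hu.trans he)

/-- The triangles on one side of the ladderpole at one of its vertices. -/
theorem exists_fan {x : Flag ι} (hx : T.IsLadder θ x) (hr : T.IsLadder θ (T.rot x)) :
    ∃ n, 0 < n ∧ (T.rot ^ n) (T.rot x).mirror = (T.across x).mirror ∧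
      (∀ i, 0 < i → i < n → θ (((T.rot ^ i) (T.rot x).mirror).angle 2) = Real.pi) ∧
      ∀ i < n, ∀ j < n, (T.rot ^ i) (T.rot x).mirror = (T.rot ^ j) (T.rot x).mirror → i = j := by
  set z := (T.rot x).mirror with hz
  have hu : T.rot (T.rot (T.across x).mirror) = z := by
    rw [rot_mirror, across_across, rot_act_swap13]
  have hw : ∀ y : Flag ι, T.IsLadder θ y → θ (y.mirror.angle 1) = Real.pi := by
    intro y hy
    rw [Flag.mirror_eq, Flag.angle_act _ _ 1 2]
    exact hy.1
  set N := Function.minimalPeriod T.rot z with hN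
  have hNpos : 0 < N :=
    Function.minimalPeriod_pos_of_mem_periodicPts (T.rot.injective.mem_periodicPts z)
  have hper : (T.rot ^ N) z = z := by
    rw [← Perm.iterate_eq_pow]
    exact Function.iterate_minimalPeriod
  have hN1 : N ≠ 1 := by
    intro h1
    rw [h1, pow_one] at hper
    exact h.rot_rot_ne z (by rw [hper, hper])
  have hN2 : N ≠ 2 := by
    intro h1
    rw [h1, pow_two, Perm.mul_apply] at hper
    exact h.rot_rot_ne z hper
  have hinj : ∀ i < N, ∀ j < N, (T.rot ^ i) z = (T.rot ^ j) z → i = j := by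
    intro i hi j hj hij
    rw [← Perm.iterate_eq_pow, ← Perm.iterate_eq_pow] at hij
    exact Function.iterate_injOn_Iio_minimalPeriod hi hj hij
  -- The last two steps of a full turn lead from `(T.across x).mirror` through the triangle of `x`
  -- back to `z`.
  obtain ⟨n, hn⟩ : ∃ n, N = n + 2 := ⟨N - 2, by omega⟩
  have hnu : (T.rot ^ n) z = (T.across x).mirror := by
    apply T.rot.injective
    apply T.rot.injective
    rw [hu, ← Perm.mul_apply, ← Perm.mul_apply, mul_assoc, ← pow_succ', ← pow_succ']
    rwa [hn] at hper
  refine ⟨n, by omega, hnu, fun i hi hin => ?_, fun i hi j hj => hinj i (by omega) j (by omega)⟩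
  have hright : T.RightVeering θ z := by
    rw [hz, ← rot_act_swap13, ← rightVeering_congr (sameCycle_rot _)]
    refine h.rightVeering ?_
    rw [Flag.angle_act _ _ 2 2]
    exact hx.1
  refine hright _ (mem_vertexLink.2 (sameCycle_rot_pow _ _))
    ((h.zero_or_pi _).resolve_right fun hpi => ?_)
  have := h.eq_of_wide (sameCycle_rot_pow z i) (sameCycle_rot_pow z n) (hw _ hr) hpi
    (by rw [hnu]; exact hw _ (h.isLadder_across hx))
    (fun he => by
      have := hinj 0 (by omega) i (by omega) he
      omega)
    (fun he => by
      have := hinj 0 (by omega) n (by omega) he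
      omega)
  have := hinj _ (by omega) _ (by omega) this
  omega

end IsVeering

/-! ### Runs of zero angles -/

namespace IsPartiallyRescued

variable (h : T.IsVeering θ) {θ' : AngleVector ι} (h' : T.IsPartiallyRescued θ θ')
include h h'

omit h in
theorem leftVeering_or_rightVeering {x : Flag ι} (hx : θ' (x.angle 1) = 0) :
    (T.LeftVeering θ x.turn ∧ T.LeftVeering θ x.turn.turn) ∨
      (T.RightVeering θ x.turn ∧ T.RightVeering θ x.turn.turn) := by
  by_cases hev : x.IsEven
  · exact h'.zero_opposite x hev hx
  · have := h'.zero_opposite (x.act (swap 2 3)) ((Flag.isEven_act_odd (by decide)).2 hev)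
      (by rwa [Flag.angle_act _ _ 1 1])
    have h1 : (x.act (swap 2 3)).turn = x.turn.turn.act (swap 2 3) := by
      simp only [Flag.turn_eq, Flag.act_act]
      congr 1; decide
    have h2 : (x.act (swap 2 3)).turn.turn = x.turn.act (swap 2 3) := by
      simp only [Flag.turn_eq, Flag.act_act]
      congr 1; decide
    rw [OppositeLadderpole, h2, h1, leftVeering_act_swap23, leftVeering_act_swap23,
      rightVeering_act_swap23, rightVeering_act_swap23] at this
    tauto

/-- The neighbors of a wide corner have different colors, so the side opposite to it is no
ladderpole segment. -/
theorem ne_pi {x : Flag ι} (hx : θ' (x.angle 1) = 0) : θ (x.angle 1) ≠ Real.pi := by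
  intro h1
  have h2 : θ (x.turn.angle 3) = Real.pi := by rwa [Flag.turn_eq, Flag.angle_act _ _ 3 1]
  have h3 : θ (x.turn.turn.angle 2) = Real.pi := by
    rwa [Flag.turn_eq, Flag.turn_eq, Flag.act_act, Flag.angle_act _ _ 2 1]
  rcases leftVeering_or_rightVeering h' hx with c | c
  · exact h.not_leftVeering h3 c.2
  · exact h.not_rightVeering h2 c.1

theorem isLadder {x : Flag ι} (hx : θ' (x.angle 1) = 0) (h2 : θ (x.angle 2) = Real.pi) :
    T.IsLadder θ x := by
  refine ⟨h2, ?_⟩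
  have h3 := h.not_leftVeering_and_rightVeering (h.leftVeering_turn_turn h2)
  rcases leftVeering_or_rightVeering h' hx with c | c
  · exact c.1
  · exact absurd c.2 h3

theorem exists_isLadder {j : ι × Fin 3} (hj : θ' j = 0) :
    ∃ x : Flag ι, x.angle 1 = j ∧ T.IsLadder θ x := by
  obtain ⟨x, -, rfl⟩ := Flag.exists_even_angle j
  rcases h.cases_angle x with c | c | c
  · exact absurd c.1 (ne_pi h h' hj)
  · exact ⟨x, rfl, isLadder h h' hj c.2.1⟩
  · have h1 : (x.act (swap 2 3)).angle 1 = x.angle 1 := Flag.angle_act _ _ 1 1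
    refine ⟨x.act (swap 2 3), h1, isLadder h h' (h1 ▸ hj) ?_⟩
    rw [Flag.angle_act _ _ 2 3]
    exact c.2.2

omit h in
theorem not_isHinge {x : Flag ι} {k : Fin 4} (hx : θ' (x.angle k) = 0) : ¬ T.IsHinge θ x.1 :=
  fun hh => (h'.hinge_pos x.1 hh _).ne' hx

omit h in
theorem exists_rot_pow_ne (x : Flag ι) : ∃ n : ℕ, θ' (((T.rot ^ n) x).angle 1) ≠ 0 := by
  by_contra! hall
  have := h'.edge x
  rw [Finset.sum_eq_zero] at this
  · linarith [Real.pi_pos]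
  · intro y hy
    obtain ⟨n, rfl⟩ := (mem_vertexLink.1 hy).exists_nat_pow_eq
    exact hall n

/-- Some zero angle has a nonzero angle on the other side of its ladderpole segment. -/
theorem exists_across_ne (h0 : ∃ j, θ' j = 0) :
    ∃ x : Flag ι, T.IsLadder θ x ∧ θ' (x.angle 1) = 0 ∧ θ' ((T.across x).angle 1) ≠ 0 := by
  by_contra! hall
  obtain ⟨j, hj⟩ := h0
  obtain ⟨x, rfl, hx⟩ := exists_isLadder h h' hj
  -- If zeros always persisted across ladderpoles, then by `across_act`, applied at the opposite
  -- edge, they would persist under `rot` and fill a whole vertex link.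
  have step : ∀ y : Flag ι, T.IsLadder θ y ∧ θ' (y.angle 1) = 0 →
      T.IsLadder θ (T.rot y) ∧ θ' ((T.rot y).angle 1) = 0 := by
    rintro y ⟨hy, hy0⟩
    refine ⟨h.isLadder_rot hy (not_isHinge h' hy0), ?_⟩
    have h1 : (y.act (swap 1 2 * swap 0 3)).angle 1 = y.angle 1 := Flag.angle_act _ _ 1 1
    have h2 : (y.act (swap 1 2 * swap 0 3)).angle 2 = y.angle 2 := Flag.angle_act _ _ 2 2
    have := hall (y.act (swap 1 2 * swap 0 3))
      (isLadder h h' (h1.symm ▸ hy0) (h2.symm ▸ hy.1)) (h1.symm ▸ hy0)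
    rwa [across_act, Flag.opp_eq, Flag.angle_act _ _ 1 1] at this
  obtain ⟨n, hn⟩ := exists_rot_pow_ne h' x
  refine hn ?_
  have : ∀ n : ℕ, T.IsLadder θ ((T.rot ^ n) x) ∧ θ' (((T.rot ^ n) x).angle 1) = 0 := by
    intro n
    induction n with
    | zero => exact ⟨hx, hj⟩
    | succ n ih =>
      rw [pow_succ', Perm.mul_apply]
      exact step _ ih
  exact (this n).2

/-- A run of zero angles along a ladderpole whose curve removes a zero. -/
theorem exists_run (h0 : ∃ j, θ' j = 0) :
    ∃ (x : Flag ι) (k : ℕ), θ' ((T.across x).angle 1) ≠ 0 ∧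
      (∀ j ≤ k, θ' (((T.rot ^ j) x).angle 1) = 0) ∧ θ' (((T.rot ^ (k + 1)) x).angle 1) ≠ 0 ∧
      (∀ j ≤ k + 1, T.IsLadder θ ((T.rot ^ j) x)) ∧
      ∀ j < k, T.rot (T.across ((T.rot ^ (j + 1)) x)) = T.across ((T.rot ^ j) x) := by
  classical
  -- The least `k` is taken over all starting flags. A nonzero angle across the interior of the run
  -- would start a shorter run, so those angles vanish. They are then not in hinges, and the far
  -- side of the ladderpole continues in step.
  have hex : ∃ (k : ℕ) (x : Flag ι), T.IsLadder θ x ∧ θ' (x.angle 1) = 0 ∧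
      θ' ((T.across x).angle 1) ≠ 0 ∧ θ' (((T.rot ^ (k + 1)) x).angle 1) ≠ 0 := by
    obtain ⟨x, hx, hx0, hx1⟩ := exists_across_ne h h' h0
    obtain ⟨n, hn⟩ := exists_rot_pow_ne h' x
    cases n with
    | zero => exact absurd hx0 hn
    | succ k => exact ⟨k, x, hx, hx0, hx1, hn⟩
  obtain ⟨x, hx, hx0, hx1, hx2⟩ := Nat.find_spec hex
  set k := Nat.find hex with hk
  have hmin : ∀ m < k, ∀ y : Flag ι, T.IsLadder θ y → θ' (y.angle 1) = 0 →
      θ' ((T.across y).angle 1) ≠ 0 → θ' (((T.rot ^ (m + 1)) y).angle 1) = 0 := by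
    intro m hm y hy hy0 hy1
    by_contra hy2
    exact Nat.find_min hex hm ⟨y, hy, hy0, hy1, hy2⟩
  have hzero : ∀ j ≤ k, θ' (((T.rot ^ j) x).angle 1) = 0 := by
    intro j hj
    cases j with
    | zero => exact hx0
    | succ j => exact hmin j hj x hx hx0 hx1
  have hlad : ∀ j ≤ k + 1, T.IsLadder θ ((T.rot ^ j) x) := by
    intro j hj
    induction j with
    | zero => exact hx
    | succ j ih =>
      rw [pow_succ', Perm.mul_apply]
      exact h.isLadder_rot (ih (by omega)) (not_isHinge h' (hzero j (by omega)))
  have hacross : ∀ j < k, θ' ((T.across ((T.rot ^ (j + 1)) x)).angle 1) = 0 := by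
    intro j hj
    by_contra hne
    obtain ⟨d, hd⟩ := Nat.exists_eq_add_of_lt hj
    have := hmin d (by omega) _ (hlad (j + 1) (by omega)) (hzero (j + 1) (by omega)) hne
    rw [← Perm.mul_apply, ← pow_add, show d + 1 + (j + 1) = k + 1 by omega] at this
    exact hx2 this
  refine ⟨x, k, hx1, hzero, hx2, hlad, fun j hj => ?_⟩
  have h1 := hlad (j + 1) (by omega)
  have h2 := h.isLadder_rot (h.isLadder_across h1) (not_isHinge h' (hacross j hj))
  rw [pow_succ', Perm.mul_apply] at h1 h2 ⊢
  exact h.rot_across_rot (hlad j (by omega)) h1 h2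

end IsPartiallyRescued
end IdealTriangulation

/-! ### Combinatorial homotopy of paths of crossings -/

/-- The cusp triangle of a flag. -/
def Flag.triangle (x : Flag ι) : ι × Fin 4 := (x.1, x.2 0)

theorem Flag.triangle_act (x : Flag ι) (q : Perm (Fin 4)) (hq : q 0 = 0) :
    (x.act q).triangle = x.triangle := by
  simp [Flag.triangle, Flag.act, hq]

namespace IdealTriangulation

theorem exit_act_swap13 (x : Flag ι) : exit (x.act (swap 1 3)) = exit x := by
  simp [exit, Flag.act, show swap (1 : Fin 4) 3 0 = 0 by decide,
    show swap (1 : Fin 4) 3 2 = 2 by decide]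

variable {T : IdealTriangulation ι}

section homotopy

theorem target_exit (x : Flag ι) : T.target (exit x) = (T.rot x).triangle := by
  simp [target, exit, Flag.triangle, rot, show swap (2 : Fin 4) 3 0 = 0 by decide]

theorem isPath_append {l l' : List (Crossing ι)} : ∀ {A C : ι × Fin 4},
    T.IsPath A (l ++ l') C ↔ ∃ B, T.IsPath A l B ∧ T.IsPath B l' C := by
  induction l with
  | nil => simp [IsPath]
  | cons d l ih => simp [IsPath, ih, and_assoc]

theorem IsPath.unique {l : List (Crossing ι)} : ∀ {A B C : ι × Fin 4},
    T.IsPath A l B → T.IsPath A l C → B = C := by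
  induction l with
  | nil =>
    intro A B C h h'
    exact Eq.trans (Eq.symm h) h'
  | cons d l ih =>
    intro A B C h h'
    exact ih h.2 h'.2

theorem isPath_rot_pow (x : Flag ι) (n : ℕ) :
    T.IsPath x.triangle ((List.range n).map fun k => exit ((T.rot ^ k) x))
      ((T.rot ^ n) x).triangle := by
  induction n with
  | zero => exact rfl
  | succ n ih =>
    rw [List.range_succ, List.map_append, isPath_append]
    refine ⟨_, ih, rfl, ?_⟩
    rw [target_exit, ← Perm.mul_apply, ← pow_succ']
    exact rfl

theorem IsNullHomotopic.insert {A B : ι × Fin 4} {p₁ p₂ e : List (Crossing ι)}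
    (he : T.IsElementaryLoop e) (hB : T.IsPath B e B) (h₁ : T.IsPath A p₁ B)
    (h : T.IsNullHomotopic A (p₁ ++ p₂)) : T.IsNullHomotopic A (p₁ ++ e ++ p₂) := by
  obtain ⟨C, hC, h₂⟩ := isPath_append.1 h.1
  obtain rfl := hC.unique h₁
  have hp : T.IsPath A (p₁ ++ e ++ p₂) A :=
    isPath_append.2 ⟨_, isPath_append.2 ⟨_, h₁, hB⟩, h₂⟩
  exact ⟨hp, .trans _ _ _ (.symm _ _ (.rel _ _ ⟨h.1, hp, p₁, p₂, e, he, rfl, rfl⟩)) h.2⟩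

theorem IsNullHomotopic.delete {A B : ι × Fin 4} {p₁ p₂ e : List (Crossing ι)}
    (he : T.IsElementaryLoop e) (hB : T.IsPath B e B) (h₁ : T.IsPath A p₁ B)
    (h : T.IsNullHomotopic A (p₁ ++ e ++ p₂)) : T.IsNullHomotopic A (p₁ ++ p₂) := by
  obtain ⟨C, hC, h₂⟩ := isPath_append.1 h.1
  obtain rfl := hC.unique (isPath_append.2 ⟨_, h₁, hB⟩)
  have hp : T.IsPath A (p₁ ++ p₂) A := isPath_append.2 ⟨_, h₁, h₂⟩
  exact ⟨hp, .trans _ _ _ (.rel _ _ ⟨hp, h.1, p₁, p₂, e, he, rfl, rfl⟩) h.2⟩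

theorem back_exit_mirror_across (x : Flag ι) :
    T.back (exit (T.across x).mirror) = exit x.mirror := by
  have key : (T.across x).mirror = (T.cross x.mirror).act (swap 1 3) := by
    rw [across, Flag.mirror_eq, Flag.mirror_eq, Flag.act_act]
    congr 1; decide
  rw [key, exit_act_swap13]
  simp [back, exit, cross, T.nbr_nbr, T.glue_glue]

theorem back_path (d : Crossing ι) : T.IsPath (d.tet, d.tip) [d, T.back d] (d.tet, d.tip) := by
  refine ⟨rfl, rfl, ?_⟩
  show T.target (T.back d) = _
  simp [target, back, T.nbr_nbr, T.glue_glue]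

/-- Pushing a path over a vertex. -/
theorem IsNullHomotopic.push {A : ι × Fin 4} {p₁ p₂ : List (Crossing ι)} {y : Flag ι} {n : ℕ}
    (hn : (T.rot ^ n) (T.rot y).mirror = (T.across y).mirror) (h₁ : T.IsPath A p₁ y.triangle)
    (h : T.IsNullHomotopic A (p₁ ++ exit y.mirror :: p₂)) :
    T.IsNullHomotopic A
      (p₁ ++ exit y :: ((List.range n).map fun i => exit ((T.rot ^ i) (T.rot y).mirror)) ++ p₂) := by
  set M := (List.range n).map fun i => exit ((T.rot ^ i) (T.rot y).mirror) with hM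
  set w := y.act (swap 1 3) with hw
  have hpow : ∀ i : ℕ, (T.rot ^ (i + 1)) w = (T.rot ^ i) (T.rot y).mirror := by
    intro i
    rw [pow_succ, Perm.mul_apply, hw, rot_act_swap13]
  have hlast : (T.rot ^ (n + 2)) w = w := by
    rw [pow_succ', Perm.mul_apply, hpow, hn, rot_mirror, across_across]
  have hloop : ((List.range (n + 2)).map fun i => exit ((T.rot ^ i) w)) =
      exit y :: M ++ [exit (T.across y).mirror] := by
    rw [List.range_succ, List.range_succ_eq_map, List.map_append, List.map_cons, List.map_map,
      List.map_singleton, hpow, hn]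
    simp only [Function.comp_def, Nat.succ_eq_add_one, hpow, pow_zero, Perm.one_apply]
    rw [hw, exit_act_swap13]
  have hwt : w.triangle = y.triangle := y.triangle_act _ (by decide)
  have hpath := isPath_rot_pow (T := T) w (n + 2)
  rw [hlast, hloop, hwt] at hpath
  have hel : T.IsElementaryLoop (exit y :: M ++ [exit (T.across y).mirror]) :=
    hloop ▸ .vertex w (n + 2) hlast
  -- Insert the full loop around the vertex. Its last crossing then cancels against `exit y.mirror`,
  -- the same side crossed in the other direction.
  have h3 := h.insert hel hpath h₁
  have h4 : p₁ ++ (exit y :: M ++ [exit (T.across y).mirror]) ++ exit y.mirror :: p₂ =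
      p₁ ++ exit y :: M ++ [exit (T.across y).mirror, exit y.mirror] ++ p₂ := by simp
  rw [h4] at h3
  rw [← back_exit_mirror_across y] at h3
  obtain ⟨B, hB, hB'⟩ := isPath_append.1 hpath
  have hB2 : B = (T.across y).mirror.triangle := hB'.1.symm
  refine h3.delete (B := B) (.backtrack _) ?_ (isPath_append.2 ⟨_, h₁, hB⟩)
  rw [hB2]
  exact back_path _

end homotopy

/-! ### The curve around a run: it closes up and is null-homotopic -/

/-- The arcs of `runCurve` before it turns around its last vertex. -/
def runForward (T : IdealTriangulation ι) (x : Flag ι) : ℕ → Flag ι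
  | 0 => x.act (swap 1 3)
  | j + 1 => (T.rot ^ (j + 1)) x

/-- The arcs of `runCurve` after it has turned around its last vertex, in reverse order. -/
def runBackward (T : IdealTriangulation ι) (x : Flag ι) : ℕ → Flag ι
  | 0 => (T.across x).mirror
  | j + 1 => T.across ((T.rot ^ (j + 1)) x)

/-- The closed curve that crosses the ladderpole segment opposite to `x`, follows the ladderpole on
one side along `k` more segments, crosses it there and comes back on the other side. -/
def runCurve (T : IdealTriangulation ι) (x : Flag ι) (k n : ℕ) : List (Flag ι) :=
  (List.range (k + 1)).map (T.runForward x) ++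
    ((List.range n).map fun i => (T.rot ^ i) ((T.rot ^ (k + 1)) x).mirror) ++
    ((List.range (k + 1)).map (T.runBackward x)).reverse

section run

variable {x : Flag ι} {k n : ℕ}

theorem exit_runForward (j : ℕ) : exit (T.runForward x j) = exit ((T.rot ^ j) x) := by
  cases j with
  | zero => exact exit_act_swap13 x
  | succ j => rfl

theorem triangle_runForward (j : ℕ) :
    (T.runForward x j).triangle = ((T.rot ^ j) x).triangle := by
  cases j with
  | zero => exact x.triangle_act _ (by decide)
  | succ j => rfl

theorem triangle_runBackward (j : ℕ) :
    (T.runBackward x j).triangle = (T.across ((T.rot ^ j) x)).triangle := by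
  cases j with
  | zero => exact Flag.triangle_act _ _ (by decide)
  | succ j => rfl

section chain

variable (hback : ∀ j < k, T.rot (T.across ((T.rot ^ (j + 1)) x)) = T.across ((T.rot ^ j) x))

theorem follows_runForward (j : ℕ) : T.Follows (T.runForward x j) ((T.rot ^ (j + 1)) x) := by
  cases j with
  | zero =>
    right
    simp only [runForward, rot_act_swap13, Flag.mirror_eq, Flag.act_act, Equiv.swap_mul_self,
      Flag.act_one, zero_add, pow_one]
  | succ j =>
    left
    rw [pow_succ' _ (j + 1), Perm.mul_apply]
    rfl

theorem follows_mirror {x y : Flag ι} (h : T.Follows x y) : T.Follows x y.mirror := by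
  rcases h with rfl | rfl
  · exact Or.inr rfl
  · left
    rw [Flag.mirror_eq, Flag.mirror_eq, Flag.act_act, Equiv.swap_mul_self, Flag.act_one]

theorem follows_runBackward {y : Flag ι} (j : ℕ) (h : T.Follows y (T.across ((T.rot ^ j) x))) :
    T.Follows y (T.runBackward x j) := by
  cases j with
  | zero => exact follows_mirror h
  | succ j => exact h

theorem follows_runBackward_zero : T.Follows (T.runBackward x 0) (T.runForward x 0) := by
  left
  rw [runBackward, runForward, rot_mirror, across_across]

include hback in
theorem chain_runCurve (hn : 0 < n)
    (hfan : (T.rot ^ n) ((T.rot ^ (k + 1)) x).mirror = (T.across ((T.rot ^ k) x)).mirror) :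
    Cycle.Chain T.Follows (T.runCurve x k n : Cycle (Flag ι)) := by
  obtain ⟨n, rfl⟩ : ∃ m, n = m + 1 := ⟨n - 1, by omega⟩
  have h1 : List.IsChain T.Follows ((List.range (k + 1)).map (T.runForward x)) := by
    rw [List.isChain_iff_getElem]
    intro i hi
    simp only [List.getElem_map, List.getElem_range]
    exact follows_runForward i
  have h2 : List.IsChain T.Follows ((List.range (n + 1)).map fun i =>
      (T.rot ^ i) ((T.rot ^ (k + 1)) x).mirror) := by
    rw [List.isChain_iff_getElem]
    intro i hi
    simp only [List.getElem_map, List.getElem_range]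
    left
    rw [pow_succ', Perm.mul_apply]
  have h3 : List.IsChain T.Follows ((List.range (k + 1)).map (T.runBackward x)).reverse := by
    rw [List.isChain_reverse, List.isChain_iff_getElem]
    intro i hi
    simp only [List.length_map, List.length_range] at hi
    simp only [List.getElem_map, List.getElem_range]
    exact follows_runBackward _ (Or.inl (hback i (by omega)).symm)
  have h4 : List.IsChain T.Follows (T.runCurve x k (n + 1)) := by
    rw [runCurve, List.isChain_append, List.isChain_append]
    refine ⟨⟨h1, h2, ?_⟩, h3, ?_⟩
    · intro a ha b hb
      rw [List.range_succ] at ha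
      rw [List.range_succ_eq_map] at hb
      simp only [List.map_append, List.map_cons, List.map_nil, List.getLast?_append, List.getLast?_singleton,
        Option.some_or, Option.mem_def, Option.some.injEq, List.head?_cons, pow_zero,
        Perm.one_apply] at ha hb
      subst ha hb
      exact follows_mirror (follows_runForward k)
    · intro a ha b hb
      rw [List.range_succ (n := n)] at ha
      rw [List.range_succ (n := k)] at hb
      simp only [List.map_append, List.map_cons, List.map_nil, List.getLast?_append, List.getLast?_singleton,
        Option.some_or, Option.mem_def, Option.some.injEq, List.reverse_append,
        List.reverse_singleton, List.singleton_append, List.head?_cons] at ha hb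
      subst ha hb
      refine follows_runBackward _ (Or.inr ?_)
      rw [← Perm.mul_apply, ← pow_succ', hfan, Flag.mirror_eq, Flag.mirror_eq, Flag.act_act,
        Equiv.swap_mul_self, Flag.act_one]
  have h5 : T.runCurve x k (n + 1) = T.runForward x 0 :: (T.runCurve x k (n + 1)).tail := by
    simp [runCurve, List.range_succ_eq_map]
  rw [h5, Cycle.chain_coe_cons, ← List.cons_append, ← h5, List.isChain_append]
  refine ⟨h4, List.isChain_singleton _, ?_⟩
  intro a ha b hb
  rw [runCurve, List.range_succ_eq_map (n := k)] at ha
  simp only [List.map_cons, List.reverse_cons, List.getLast?_append, List.getLast?_singleton,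
    Option.some_or, Option.mem_def, Option.some.injEq, List.head?_cons] at ha hb
  subst ha hb
  exact follows_runBackward_zero

end chain

/-- The curve grows from a backtrack across the first ladderpole segment by pushing it over the
successive ladderpole vertices. -/
theorem isTrivialCurve_runCurve
    (hback : ∀ j < k, T.rot (T.across ((T.rot ^ (j + 1)) x)) = T.across ((T.rot ^ j) x))
    (hfan : (T.rot ^ n) ((T.rot ^ (k + 1)) x).mirror = (T.across ((T.rot ^ k) x)).mirror) :
    T.IsTrivialCurve (T.runCurve x k n) := by
  refine ⟨x.triangle, ?_⟩
  have hex : ∀ m, ((List.range m).map (T.runForward x)).map exit =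
      (List.range m).map fun j => exit ((T.rot ^ j) x) := by
    intro m
    rw [List.map_map]
    exact List.map_congr_left fun j _ => exit_runForward j
  have key : ∀ j ≤ k, T.IsNullHomotopic x.triangle
      (((List.range j).map fun i => exit ((T.rot ^ i) x)) ++ exit ((T.rot ^ j) x).mirror ::
        (((List.range (j + 1)).map (T.runBackward x)).reverse.map exit)) := by
    intro j
    induction j with
    | zero =>
      intro _
      have h1 : T.back (exit x.mirror) = exit (T.across x).mirror := by
        conv_lhs => rw [← across_across T x]
        rw [back_exit_mirror_across]
      have h2 := (back_path (T := T) (exit x.mirror))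
      rw [h1] at h2
      have h3 : ((exit x.mirror).tet, (exit x.mirror).tip) = x.triangle :=
        x.triangle_act (swap 1 2) (by decide)
      rw [h3] at h2
      have h4 : T.IsNullHomotopic x.triangle ([] ++ []) := ⟨rfl, .refl _⟩
      have := h4.insert (p₁ := []) (p₂ := []) (h1 ▸ .backtrack (exit x.mirror)) h2 rfl
      simpa [runBackward] using this
    | succ j ih =>
      intro hj
      have hr : T.rot ((T.rot ^ j) x) = (T.rot ^ (j + 1)) x := by
        rw [pow_succ', Perm.mul_apply]
      -- By `hback`, a turn about an intermediate ladderpole vertex closes after four corners. Only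
      -- the last vertex, treated after the induction, carries a fan of general length `n`.
      have hfan2 : (T.rot ^ 2) (T.rot ((T.rot ^ j) x)).mirror =
          (T.across ((T.rot ^ j) x)).mirror := by
        rw [pow_two, Perm.mul_apply, rot_mirror, rot_act_swap13, hr, hback j (by omega)]
      have := (ih (by omega)).push hfan2 (isPath_rot_pow x j)
      convert this using 1
      rw [List.range_succ (n := j), List.range_succ (n := j + 1)]
      simp [List.range_succ, hr, rot_mirror, exit_act_swap13, runBackward]
  have h := (key k le_rfl).push (hn := by rwa [← Perm.mul_apply, ← pow_succ'])
    (isPath_rot_pow x k)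
  convert h using 1
  rw [runCurve, List.map_append, List.map_append, hex, List.range_succ (n := k),
    ← Perm.mul_apply, ← pow_succ']
  simp [Function.comp_def]

end run
end IdealTriangulation

/-! ### The curve visits each triangle at most once and removes a zero -/

theorem list_sum_apply {κ : Type*} (l : List (κ → ℝ)) (j : κ) :
    l.sum j = (l.map fun f => f j).sum := by
  induction l with
  | nil => rfl
  | cons f l ih => simp [ih]

/-- If no arc of a curve leaves its triangle through a side opposite to a zero angle, the
deformation does not decrease the zero angles. -/
theorem curveDeformation_nonneg {γ : List (Flag ι)} {j : ι × Fin 3}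
    (h : ∀ a ∈ γ, a.angle 2 ≠ j) : 0 ≤ curveDeformation γ j := by
  classical
  rw [curveDeformation, list_sum_apply]
  refine List.sum_nonneg fun r hr => ?_
  simp only [List.map_map, List.mem_map, Function.comp_apply] at hr
  obtain ⟨a, ha, rfl⟩ := hr
  rw [arcDeformation_apply, if_neg (h a ha).symm, sub_zero]
  split_ifs <;> norm_num

theorem curveDeformation_pos {a : Flag ι} {γ : List (Flag ι)} {j : ι × Fin 3}
    (h : ∀ b ∈ a :: γ, b.angle 2 ≠ j) (ha : a.angle 3 = j) : 0 < curveDeformation (a :: γ) j := by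
  classical
  have h1 := curveDeformation_nonneg (γ := γ) (j := j) fun b hb => h b (List.mem_cons_of_mem _ hb)
  have h2 : curveDeformation (a :: γ) j = arcDeformation a j + curveDeformation γ j := by
    simp [curveDeformation]
  rw [h2, arcDeformation_apply, if_neg (h a (by simp)).symm, if_pos ha.symm]
  linarith

namespace IdealTriangulation

variable {T : IdealTriangulation ι}

theorem sign_rot (x : Flag ι) : Perm.sign (T.rot x).2 = Perm.sign x.2 := by
  have : Perm.sign (swap (2 : Fin 4) 3) = -1 := by decide
  simp [rot, T.sign_glue, this]

theorem sign_rot_pow (x : Flag ι) (n : ℕ) :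
    Perm.sign ((T.rot ^ n) x).2 = Perm.sign x.2 := by
  induction n with
  | zero => rfl
  | succ n ih => rw [pow_succ', Perm.mul_apply, sign_rot, ih]

theorem sign_across (x : Flag ι) : Perm.sign (T.across x).2 = Perm.sign x.2 := by
  have h1 : Perm.sign (swap (1 : Fin 4) 2) = -1 := by decide
  have h2 : Perm.sign (swap (2 : Fin 4) 3) = -1 := by decide
  simp [across, cross, Flag.act, T.sign_glue, h1, h2]

variable [Fintype ι] {θ : AngleVector ι}

namespace IsVeering

variable (h : T.IsVeering θ)
include h

/-- Parity and the position of the wide corner single out one flag per triangle, so distinctness of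
triangles becomes distinctness of normalized flags. -/
theorem eq_of_triangle_eq {x y : Flag ι} (hx : θ (x.angle 2) = Real.pi)
    (hy : θ (y.angle 2) = Real.pi) (ht : x.triangle = y.triangle)
    (hs : Perm.sign x.2 = Perm.sign y.2) : x = y := by
  have hp := Real.pi_pos
  have ht1 : x.1 = y.1 := congrArg (fun A : ι × Fin 4 => A.1) ht
  obtain ⟨q, rfl⟩ := Flag.exists_act_eq ht1
  have h0 : q 0 = 0 := by
    have := congrArg (fun A : ι × Fin 4 => A.2) ht
    simpa [Flag.triangle, Flag.act] using this.symm
  have hq : Perm.sign q = 1 := by simpa [Flag.sign_act] using hs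
  have key : ∀ q : Perm (Fin 4), q 0 = 0 → Perm.sign q = 1 →
      q = 1 ∨ q = swap 1 2 * swap 2 3 ∨ q = swap 2 3 * swap 1 2 := by decide
  rcases key q h0 hq with rfl | rfl | rfl
  · simp
  · rw [x.angle_act _ 2 3] at hy
    rcases h.cases_angle x with c | c | c <;> linarith [c.2.1, c.2.2]
  · rw [x.angle_act _ 2 1] at hy
    rcases h.cases_angle x with c | c | c <;> linarith [c.1, c.2.1]

/-- If the rotation closed up within thin corners, the angle sum at the vertex would be zero. -/
theorem rot_pow_ne {x : Flag ι} {d : ℕ} (hd : 0 < d)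
    (hthin : ∀ j < d, θ (((T.rot ^ j) x).angle 1) = 0) : (T.rot ^ d) x ≠ x := by
  intro hx
  have hmul : ∀ m, (T.rot ^ (d * m)) x = x := by
    intro m
    induction m with
    | zero => simp
    | succ m ih => rw [Nat.mul_succ, pow_add, Perm.mul_apply, hx, ih]
  have hall : ∀ n : ℕ, θ (((T.rot ^ n) x).angle 1) = 0 := by
    intro n
    rw [← Nat.mod_add_div n d, pow_add, Perm.mul_apply, hmul]
    exact hthin _ (Nat.mod_lt _ hd)
  have := h.edge x
  rw [Finset.sum_eq_zero] at this
  · linarith [Real.pi_pos]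
  · intro y hy
    obtain ⟨n, rfl⟩ := (mem_vertexLink.1 hy).exists_nat_pow_eq
    exact hall n

/-- Equality would make two rotations about the vertex of `(T.rot x).turn` close up. -/
theorem across_ne_rot (x : Flag ι) : T.across x ≠ T.rot x := by
  intro he
  refine h.rot_rot_ne (T.rot x).turn ?_
  rw [rot_turn_rot, rot_turn_turn, he]

section run

variable {x : Flag ι} {k n : ℕ} (hlad : ∀ j ≤ k + 1, T.IsLadder θ ((T.rot ^ j) x))

include hlad in
theorem rot_pow_injOn : Set.InjOn (fun j : ℕ => (T.rot ^ j) x) {j | j ≤ k + 1} := by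
  have key : ∀ i j : ℕ, i < j → j ≤ k + 1 → (T.rot ^ i) x ≠ (T.rot ^ j) x := by
    intro i j hij hj he
    obtain ⟨d, rfl⟩ := Nat.exists_eq_add_of_lt hij
    rw [add_assoc, pow_add, Perm.mul_apply] at he
    refine h.rot_pow_ne (d := d + 1) (by omega) (fun l hl => ?_)
      ((T.rot ^ i).injective he).symm
    exact h.angle_one_eq_zero (hlad l (by omega)).1
  intro i hi j hj he
  rcases lt_trichotomy i j with hij | hij | hij
  · exact absurd he (key i j hij hj)
  · exact hij
  · exact absurd he.symm (key j i hij hi)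

theorem across_rot_pow_ne
    (hback : ∀ j < k, T.rot (T.across ((T.rot ^ (j + 1)) x)) = T.across ((T.rot ^ j) x))
    (i j : ℕ) (hi : i ≤ k + 1) (hj : j ≤ k + 1) :
    T.across ((T.rot ^ i) x) ≠ (T.rot ^ j) x := by
  -- A coincidence at distance `d + 2` moves inward by `hback` to distance `d`; the distances 0 and
  -- 1 are excluded directly.
  have key : ∀ d i : ℕ, i + d ≤ k + 1 → T.across ((T.rot ^ i) x) ≠ (T.rot ^ (i + d)) x := by
    intro d
    induction d using Nat.strong_induction_on with
    | _ d ih =>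
      intro i hi he
      match d with
      | 0 => exact T.across_ne _ he
      | 1 =>
        rw [pow_succ', Perm.mul_apply] at he
        exact h.across_ne_rot _ he
      | d + 2 =>
        rw [← hback i (by omega), show i + (d + 2) = (i + 1 + d) + 1 by omega,
          pow_succ' _ (i + 1 + d), Perm.mul_apply] at he
        exact ih d (by omega) (i + 1) (by omega) (T.rot.injective he)
  rcases le_total i j with hij | hij
  · obtain ⟨d, rfl⟩ := Nat.exists_eq_add_of_le hij
    exact key d i hj
  · obtain ⟨d, rfl⟩ := Nat.exists_eq_add_of_le hij
    intro he
    refine key d j hi ?_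
    rw [← he, across_across]

include hlad in
theorem nodup_runCurve
    (hback : ∀ j < k, T.rot (T.across ((T.rot ^ (j + 1)) x)) = T.across ((T.rot ^ j) x))
    (hthin : ∀ i, 0 < i → i < n →
      θ (((T.rot ^ i) ((T.rot ^ (k + 1)) x).mirror).angle 2) = Real.pi)
    (hinj : ∀ i < n, ∀ j < n, (T.rot ^ i) ((T.rot ^ (k + 1)) x).mirror =
      (T.rot ^ j) ((T.rot ^ (k + 1)) x).mirror → i = j) :
    ((T.runCurve x k n).map Flag.triangle).Nodup := by
  set z := ((T.rot ^ (k + 1)) x).mirror with hz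
  have hne := h.across_rot_pow_ne hback
  have hF := h.rot_pow_injOn hlad
  -- Normalized flags of the fan triangles: wide corner at position 2 and the parity of `x`. The
  -- triangle `i = 0` is separate because its wide corner is at the fan vertex.
  let u : ℕ → Flag ι := fun i =>
    if i = 0 then (T.rot ^ (k + 1)) x else ((T.rot ^ i) z).act (swap 1 3)
  have hu0 : u 0 = (T.rot ^ (k + 1)) x := if_pos rfl
  have hus : ∀ i, u (i + 1) = ((T.rot ^ (i + 1)) z).act (swap 1 3) := fun i => if_neg (by omega)
  have hu1 : u 1 = T.across ((T.rot ^ (k + 1)) x) := by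
    rw [hus 0, zero_add, pow_one, hz, rot_mirror, Flag.act_act, Equiv.swap_mul_self, Flag.act_one]
  have hmw : ∀ y : Flag ι, T.IsLadder θ y → θ (y.mirror.angle 1) = Real.pi := by
    intro y hy
    rw [Flag.mirror_eq, Flag.angle_act _ _ 1 2]
    exact hy.1
  -- If it were a ladder flag, the preceding fan triangle, which lies across its side, would be wide
  -- at the fan vertex.
  have hu2 : ∀ i, i + 2 < n → ¬ T.IsLadder θ (u (i + 2)) := by
    intro i hi hl
    have h1 := hmw _ (h.isLadder_across hl)
    have h2 : T.rot (T.across (u (i + 2))).mirror = T.rot ((T.rot ^ (i + 1)) z) := by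
      rw [rot_mirror, across_across, hus, Flag.act_act, Equiv.swap_mul_self, Flag.act_one,
        pow_succ' _ (i + 1), Perm.mul_apply]
    rw [T.rot.injective h2, h.angle_one_eq_zero (hthin (i + 1) (by omega) (by omega))] at h1
    exact Real.pi_pos.ne h1
  have hG : ∀ j ≤ k + 1, T.IsLadder θ (T.across ((T.rot ^ j) x)) :=
    fun j hj => h.isLadder_across (hlad j hj)
  have hut : ∀ i, (u i).triangle = ((T.rot ^ i) z).triangle := by
    intro i
    cases i with
    | zero => rw [hu0, hz]; exact (Flag.triangle_act _ (swap 1 2) (by decide)).symm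
    | succ i => rw [hus]; exact Flag.triangle_act _ _ (by decide)
  set S := (List.range (k + 1)).map (fun j => (T.rot ^ j) x) ++ (List.range n).map u ++
    ((List.range (k + 1)).map fun j => T.across ((T.rot ^ j) x)).reverse with hS
  have hST : (T.runCurve x k n).map Flag.triangle = S.map Flag.triangle := by
    simp only [runCurve, hS, List.map_append, List.map_map, List.map_reverse, Function.comp_def,
      triangle_runForward, triangle_runBackward, hut]
    rfl
  have hSwide : ∀ y ∈ S, θ (y.angle 2) = Real.pi ∧ Perm.sign y.2 = Perm.sign x.2 := by
    intro y hy
    simp only [hS, List.mem_append, List.mem_reverse, List.mem_map, List.mem_range] at hy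
    rcases hy with (⟨j, hj, rfl⟩ | ⟨i, hi, rfl⟩) | ⟨j, hj, rfl⟩
    · exact ⟨(hlad j (by omega)).1, sign_rot_pow _ _⟩
    · cases i with
      | zero => rw [hu0]; exact ⟨(hlad _ le_rfl).1, sign_rot_pow _ _⟩
      | succ i =>
        rw [hus]
        refine ⟨?_, ?_⟩
        · rw [Flag.angle_act _ _ 2 2]
          exact hthin _ (by omega) hi
        · have h1 : Perm.sign (swap (1 : Fin 4) 3) = -1 := by decide
          have h2 : Perm.sign (swap (1 : Fin 4) 2) = -1 := by decide
          rw [Flag.sign_act, sign_rot_pow, hz, Flag.mirror_eq, Flag.sign_act, sign_rot_pow, h1, h2]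
          simp
    · exact ⟨(hG j (by omega)).1, by rw [sign_across, sign_rot_pow]⟩
  rw [hST]
  refine List.Nodup.map_on (fun y hy w hw hyw => h.eq_of_triangle_eq (hSwide y hy).1 (hSwide w hw).1
    hyw ((hSwide y hy).2.trans (hSwide w hw).2.symm)) ?_
  have hFu : ∀ j ≤ k, ∀ i < n, (T.rot ^ j) x ≠ u i := by
    intro j hj i hi he
    match i with
    | 0 =>
      rw [hu0] at he
      have := hF (show j ≤ k + 1 by omega) (show k + 1 ≤ k + 1 by omega) he
      omega
    | 1 =>
      rw [hu1] at he
      exact hne _ _ le_rfl (by omega) he.symm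
    | i + 2 => exact hu2 i hi (he ▸ hlad j (by omega))
  have hGu : ∀ j ≤ k, ∀ i < n, T.across ((T.rot ^ j) x) ≠ u i := by
    intro j hj i hi he
    match i with
    | 0 =>
      rw [hu0] at he
      exact hne _ _ (by omega) le_rfl he
    | 1 =>
      rw [hu1] at he
      have he' := congrArg T.across he
      rw [across_across, across_across] at he'
      have := hF (show j ≤ k + 1 by omega) (show k + 1 ≤ k + 1 by omega) he'
      omega
    | i + 2 => exact hu2 i hi (he ▸ hG j (by omega))
  rw [hS, List.nodup_append, List.nodup_append]
  refine ⟨⟨?_, ?_, ?_⟩, ?_, ?_⟩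
  · refine List.Nodup.map_on (fun i hi j hj hij => hF ?_ ?_ hij) List.nodup_range
    · exact (List.mem_range.1 hi).le
    · exact (List.mem_range.1 hj).le
  · refine List.Nodup.map_on (fun i hi j hj hij => ?_) List.nodup_range
    rw [List.mem_range] at hi hj
    have key : ∀ i < n, u 0 = u i → i = 0 := by
      intro i hi he
      match i with
      | 0 => rfl
      | 1 =>
        rw [hu0, hu1] at he
        exact absurd he.symm (hne _ _ le_rfl le_rfl)
      | i + 2 => exact absurd (he ▸ hu0.symm ▸ hlad _ le_rfl) (hu2 i hi)
    match i, j with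
    | 0, j => exact (key j hj hij).symm
    | i + 1, 0 => exact key _ hi hij.symm
    | i + 1, j + 1 =>
      rw [hus, hus] at hij
      exact hinj _ hi _ hj (Flag.act_injective _ hij)
  · intro a ha b hb
    simp only [List.mem_map, List.mem_range] at ha hb
    obtain ⟨j, hj, rfl⟩ := ha
    obtain ⟨i, hi, rfl⟩ := hb
    exact hFu j (by omega) i hi
  · rw [List.nodup_reverse]
    refine List.Nodup.map_on (fun i hi j hj hij => hF ?_ ?_ ?_) List.nodup_range
    · exact (List.mem_range.1 hi).le
    · exact (List.mem_range.1 hj).le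
    · simpa [across_across] using congrArg T.across hij
  · intro a ha b hb
    simp only [List.mem_append, List.mem_reverse, List.mem_map, List.mem_range] at ha hb
    obtain ⟨j, hj, rfl⟩ := hb
    rcases ha with ⟨i, hi, rfl⟩ | ⟨i, hi, rfl⟩
    · exact (hne _ _ (by omega) (by omega)).symm
    · exact (hGu j (by omega) i hi).symm

end run

end IsVeering

theorem IsPartiallyRescued.exists_curve (h : T.IsVeering θ) {θ' : AngleVector ι}
    (h' : T.IsPartiallyRescued θ θ') (h0 : ∃ j, θ' j = 0) :
    ∃ γ : List (Flag ι), T.IsSimpleNormalCurve γ ∧ T.IsTrivialCurve γ ∧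
      ∀ᶠ t in 𝓝[>] (0 : ℝ), T.IsPartiallyRescued θ (θ' + t • curveDeformation γ) ∧
        {j | (θ' + t • curveDeformation γ) j = 0}.ncard < {j | θ' j = 0}.ncard := by
  obtain ⟨x, k, hx1, hzero, hx2, hlad, hback⟩ := exists_run h h' h0
  have hr : T.rot ((T.rot ^ k) x) = (T.rot ^ (k + 1)) x := by rw [pow_succ', Perm.mul_apply]
  obtain ⟨n, hn, hfan, hthin, hinj⟩ := h.exists_fan (hlad k (by omega)) (hr ▸ hlad (k + 1) le_rfl)
  rw [hr] at hfan hthin hinj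
  have hcons : T.runCurve x k n = x.act (swap 1 3) :: (T.runCurve x k n).tail := by
    simp [runCurve, List.range_succ_eq_map, runForward]
  have hcurve : T.IsSimpleNormalCurve (T.runCurve x k n) :=
    ⟨by rw [hcons]; simp, chain_runCurve hback hn hfan, h.nodup_runCurve hlad hback hthin hinj⟩
  have hwide : ∀ {a : Flag ι}, θ (a.angle 2) = Real.pi → θ' (a.angle 2) ≠ 0 := by
    intro a ha ha0
    have h1 : (a.act (swap 1 2)).angle 1 = a.angle 2 := Flag.angle_act _ _ 1 2
    exact ne_pi h h' (h1.symm ▸ ha0) (h1.symm ▸ ha)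
  -- All arcs leave opposite a wide angle, except the two that cross the ladderpole at the ends of
  -- the run. Those leave opposite the angles known to be nonzero by `hx2` and `hx1`.
  have harc : ∀ a ∈ T.runCurve x k n, θ' (a.angle 2) ≠ 0 := by
    intro a ha
    simp only [runCurve, List.mem_append, List.mem_reverse, List.mem_map, List.mem_range] at ha
    rcases ha with (⟨j, hj, rfl⟩ | ⟨i, hi, rfl⟩) | ⟨j, hj, rfl⟩
    · cases j with
      | zero =>
        refine hwide ?_
        rw [runForward, Flag.angle_act _ _ 2 2]
        exact (hlad 0 (by omega)).1
      | succ j => exact hwide (hlad (j + 1) (by omega)).1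
    · cases i with
      | zero =>
        rw [pow_zero, Perm.one_apply, Flag.mirror_eq, Flag.angle_act _ _ 2 1]
        exact hx2
      | succ i => exact hwide (hthin _ (by omega) hi)
    · cases j with
      | zero =>
        rw [runBackward, Flag.mirror_eq, Flag.angle_act _ _ 2 1]
        exact hx1
      | succ j => exact hwide (h.isLadder_across (hlad (j + 1) (by omega))).1
  have harc' : ∀ j, θ' j = 0 → ∀ a ∈ T.runCurve x k n, a.angle 2 ≠ j := by
    rintro j hj a ha rfl
    exact harc a ha hj
  refine ⟨_, hcurve, isTrivialCurve_runCurve hback hfan,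
    h'.eventually_add_smul (isTangent_curveDeformation hcurve)
      (fun j hj => curveDeformation_nonneg (harc' j hj)) ⟨x.angle 1, hzero 0 (by omega), ?_⟩⟩
  have := harc' (x.angle 1) (hzero 0 (by omega))
  rw [hcons] at this ⊢
  exact curveDeformation_pos this (Flag.angle_act _ _ 3 1)

end IdealTriangulation

/-! ### The first deformation, computed tetrahedron by tetrahedron -/

theorem Flag.turn_turn_turn (x : Flag ι) : x.turn.turn.turn = x := by
  simp only [Flag.turn_eq, Flag.act_act]
  convert Flag.act_one x using 2
  decide

theorem Flag.isEven_turn {x : Flag ι} : x.turn.IsEven ↔ x.IsEven :=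
  Flag.isEven_act (by decide)

theorem Flag.eq_angle {x : Flag ι} {j : ι × Fin 3} (hj : j.1 = x.1) :
    j = x.angle 1 ∨ j = x.angle 2 ∨ j = x.angle 3 := by
  have key : ∀ (p : Perm (Fin 4)) (q : Fin 3), q = oppositePair (p 0) (p 1) ∨
      q = oppositePair (p 0) (p 2) ∨ q = oppositePair (p 0) (p 3) := by decide
  obtain ⟨i, q⟩ := j
  obtain rfl : i = x.1 := hj
  simpa only [Flag.angle, Prod.mk.injEq, true_and] using key x.2 q

namespace IdealTriangulation

variable {T : IdealTriangulation ι} [Fintype ι] {θ : AngleVector ι}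

open Classical in
/-- The color of the vertex at which a flag is based, as a sign. -/
def color (T : IdealTriangulation ι) (θ : AngleVector ι) (x : Flag ι) : ℝ :=
  if T.LeftVeering θ x then 1 else -1

theorem color_eq_one {x : Flag ι} : T.color θ x = 1 ↔ T.LeftVeering θ x := by
  unfold color
  split_ifs with hx
  · norm_num [hx]
  · norm_num [hx]

theorem color_eq_neg_one {x : Flag ι} : T.color θ x = -1 ↔ ¬ T.LeftVeering θ x := by
  unfold color
  split_ifs with hx
  · norm_num [hx]
  · norm_num [hx]

theorem color_cases (x : Flag ι) : T.color θ x = 1 ∨ T.color θ x = -1 := by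
  rw [color_eq_one, color_eq_neg_one]
  exact em _

theorem color_congr_of_iff {x y : Flag ι} (h : T.LeftVeering θ x ↔ T.LeftVeering θ y) :
    T.color θ x = T.color θ y := by
  by_cases hx : T.LeftVeering θ x
  · rw [color_eq_one.2 hx, color_eq_one.2 (h.1 hx)]
  · rw [color_eq_neg_one.2 hx, color_eq_neg_one.2 (mt h.2 hx)]

theorem color_congr {x y : Flag ι} (h : T.rot.SameCycle x y) : T.color θ x = T.color θ y :=
  color_congr_of_iff (leftVeering_congr h)

theorem color_flip (x : Flag ι) :
    T.color θ (x.act (swap 0 1 * swap 2 3)) = T.color θ x := by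
  refine color_congr_of_iff ?_
  rw [← Flag.act_act, leftVeering_act_swap23, rightVeering_act_swap01]

omit [Fintype ι] in
theorem isEven_rot_pow {x : Flag ι} {n : ℕ} : ((T.rot ^ n) x).IsEven ↔ x.IsEven := by
  rw [Flag.IsEven, Flag.IsEven, sign_rot_pow]

theorem filter_vertexLink_eq {x : Flag ι} (hx : x.IsEven) [DecidablePred (Flag.IsEven (ι := ι))]
    [DecidableEq (Finset (Flag ι))] :
    (Finset.univ.filter Flag.IsEven).filter (fun y => T.vertexLink y = T.vertexLink x) =
      T.vertexLink x := by
  ext y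
  simp only [Finset.mem_filter, Finset.mem_univ, true_and, mem_vertexLink]
  constructor
  · rintro ⟨-, hy⟩
    rw [← mem_vertexLink, ← hy]
    exact mem_vertexLink_self y
  · intro hy
    refine ⟨?_, (vertexLink_eq hy).symm⟩
    obtain ⟨n, rfl⟩ := hy.exists_nat_pow_eq
    exact isEven_rot_pow.2 hx

open Classical in
-- Each even flag lies in exactly one vertex link, so the sum over vertices can be regrouped by
-- triangles and then by tetrahedra.
theorem blueMinusRed_eq : T.blueMinusRed θ =
    (1 / 2 : ℝ) • ∑ y ∈ Finset.univ.filter Flag.IsEven, -(T.color θ y • arcDeformation y) := by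
  rw [blueMinusRed]
  congr 1
  rw [← Finset.sum_fiberwise_of_maps_to (t := T.cuspVertices) (g := T.vertexLink)
    (fun x hx => Finset.mem_image_of_mem _ hx), ← Finset.sum_coe_sort T.cuspVertices]
  refine Finset.sum_congr rfl fun V _ => ?_
  have hV := (Finset.mem_image.1 V.2).choose_spec
  have hV1 : (T.cornerAt V).IsEven := (Finset.mem_filter.1 hV.1).2
  have hV2 : T.vertexLink (T.cornerAt V) = V := hV.2
  have h1 : ∀ y ∈ T.vertexLink (T.cornerAt V), -(T.color θ y • arcDeformation y) =
      -(T.color θ (T.cornerAt V) • arcDeformation y) := by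
    intro y hy
    rw [color_congr (mem_vertexLink.1 hy)]
  rw [← hV2, filter_vertexLink_eq hV1, Finset.sum_congr rfl h1, Finset.sum_neg_distrib,
    ← Finset.smul_sum, color, clockwiseDeformation]
  split_ifs <;> simp

/-- The contribution of a cusp triangle to `blueMinusRed`. -/
theorem IsVeering.triangle_sum (h : T.IsVeering θ) [DecidableEq ι] {y : Flag ι}
    (hy : θ (y.angle 2) = Real.pi) (j : ι × Fin 3) :
    -(T.color θ y * arcDeformation y j) + -(T.color θ y.turn * arcDeformation y.turn j) +
      -(T.color θ y.turn.turn * arcDeformation y.turn.turn j) =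
    -2 * (if j = y.angle 2 then 1 else 0) +
      (1 + T.color θ y.turn) * (if j = y.angle 3 then 1 else 0) +
      (1 - T.color θ y.turn) * (if j = y.angle 1 then 1 else 0) := by
  rw [color_eq_neg_one.2 (h.not_leftVeering hy), color_eq_one.2 (h.leftVeering_turn_turn hy)]
  simp only [arcDeformation_apply]
  rw [show y.turn.turn.angle 2 = y.angle 1 by
      rw [Flag.turn_eq, Flag.turn_eq, Flag.act_act, y.angle_act _ 2 1],
    show y.turn.turn.angle 3 = y.angle 2 by
      rw [Flag.turn_eq, Flag.turn_eq, Flag.act_act, y.angle_act _ 3 2],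
    show y.turn.angle 2 = y.angle 3 by rw [Flag.turn_eq, y.angle_act _ 2 3],
    show y.turn.angle 3 = y.angle 1 by rw [Flag.turn_eq, y.angle_act _ 3 1]]
  ring

/-- Even permutations factor through the Klein four-group (which permutes the four cusp triangles
and fixes every angle index) and the three turns within a triangle. -/
theorem sum_even_perm (f : Perm (Fin 4) → ℝ) :
    ∑ q, (if Perm.sign q = 1 then f q else 0) =
      ∑ v ∈ ({1, swap 0 2 * swap 1 3, swap 0 1 * swap 2 3, swap 1 2 * swap 0 3} :
        Finset (Perm (Fin 4))),
        (f v + f (v * (swap 1 2 * swap 2 3)) +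
          f (v * (swap 1 2 * swap 2 3) * (swap 1 2 * swap 2 3))) := by
  have : (Finset.univ.filter fun q : Perm (Fin 4) => Perm.sign q = 1) =
      ({1, swap 0 2 * swap 1 3, swap 0 1 * swap 2 3, swap 1 2 * swap 0 3} :
        Finset (Perm (Fin 4))) ∪
      (({1, swap 0 2 * swap 1 3, swap 0 1 * swap 2 3, swap 1 2 * swap 0 3} :
        Finset (Perm (Fin 4))).image (· * (swap 1 2 * swap 2 3)) ∪
      ({1, swap 0 2 * swap 1 3, swap 0 1 * swap 2 3, swap 1 2 * swap 0 3} :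
        Finset (Perm (Fin 4))).image (· * (swap 1 2 * swap 2 3) * (swap 1 2 * swap 2 3))) := by
    decide +kernel
  rw [← Finset.sum_filter, this, Finset.sum_union (by decide +kernel),
    Finset.sum_union (by decide +kernel), Finset.sum_image (by simp), Finset.sum_image (by simp),
    Finset.sum_add_distrib, Finset.sum_add_distrib, add_assoc]

/-- Two of the four triangles have their wide corner on the diagonal of `x.turn`, the other two on
that of `x.turn.opp`. The factor one half turns these double counts into one color each. -/
theorem IsVeering.blueMinusRed_apply (h : T.IsVeering θ) [DecidableEq ι] {x : Flag ι}
    (hx : θ (x.angle 2) = Real.pi) (hev : x.IsEven) {j : ι × Fin 3} (hj : j.1 = x.1) :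
    T.blueMinusRed θ j = -4 * (if j = x.angle 2 then 1 else 0) +
      (2 + (T.color θ x.turn + T.color θ x.turn.opp)) * (if j = x.angle 3 then 1 else 0) +
      (2 - (T.color θ x.turn + T.color θ x.turn.opp)) * (if j = x.angle 1 then 1 else 0) := by
  classical
  have hv : ∀ v : Perm (Fin 4), θ ((x.act v).angle 2) = Real.pi →
      -(T.color θ (x.act v) * arcDeformation (x.act v) j) +
        -(T.color θ (x.act (v * (swap 1 2 * swap 2 3))) *
          arcDeformation (x.act (v * (swap 1 2 * swap 2 3))) j) +
        -(T.color θ (x.act (v * (swap 1 2 * swap 2 3) * (swap 1 2 * swap 2 3))) *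
          arcDeformation (x.act (v * (swap 1 2 * swap 2 3) * (swap 1 2 * swap 2 3))) j) =
      -2 * (if j = (x.act v).angle 2 then 1 else 0) +
        (1 + T.color θ (x.act v).turn) * (if j = (x.act v).angle 3 then 1 else 0) +
        (1 - T.color θ (x.act v).turn) * (if j = (x.act v).angle 1 then 1 else 0) := by
    intro v hv
    simpa only [Flag.turn_eq, Flag.act_act] using h.triangle_sum hv j
  have hsum : T.blueMinusRed θ j = (1 / 2 : ℝ) * ∑ q, (if Perm.sign q = 1 then
      -(T.color θ (x.act q) * arcDeformation (x.act q) j) else 0) := by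
    rw [blueMinusRed_eq, Pi.smul_apply, smul_eq_mul, Finset.sum_apply, Finset.sum_filter]
    congr 1
    have h1 : ∀ y : Flag ι, (if y.IsEven then (-(T.color θ y • arcDeformation y)) j else 0) =
        if y.1 = x.1 then
          (if y.IsEven then -(T.color θ y * arcDeformation y j) else 0) else 0 := by
      intro y
      by_cases hy : y.1 = x.1
      · simp [hy]
      · have : arcDeformation y j = 0 := by
          have hne : ∀ k, j ≠ y.angle k := by
            rintro k rfl
            exact hy hj
          simp [arcDeformation_apply, hne]
        simp [hy, this]
    rw [Finset.sum_congr rfl fun y _ => h1 y, x.sum_eq_sum_act]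
    refine Finset.sum_congr rfl fun q _ => ?_
    have : (x.act q).IsEven ↔ Perm.sign q = 1 := by
      have hev' : Perm.sign x.2 = 1 := hev
      rw [Flag.IsEven, Flag.sign_act, hev', one_mul]
    simp only [this]
  have hc1 : T.color θ (x.act (swap 0 2 * swap 1 3)).turn = T.color θ x.turn := by
    rw [← color_flip x.turn, Flag.turn_eq, Flag.turn_eq, Flag.act_act, Flag.act_act]
    congr 2; decide
  have hc2 : T.color θ (x.act (swap 1 2 * swap 0 3)).turn = T.color θ x.turn.opp := by
    rw [Flag.turn_eq, Flag.opp_eq, Flag.turn_eq, Flag.act_act, Flag.act_act]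
    congr 2; decide
  have hc3 : T.color θ (x.act (swap 0 1 * swap 2 3)).turn = T.color θ x.turn.opp := by
    rw [← color_flip x.turn.opp, Flag.opp_eq, Flag.turn_eq, Flag.turn_eq, Flag.act_act,
      Flag.act_act, Flag.act_act]
    congr 2; decide
  rw [hsum, sum_even_perm]
  repeat rw [Finset.sum_insert (by decide)]
  rw [Finset.sum_singleton, hv 1 (by simpa using hx), hv _ (by rwa [x.angle_act _ 2 2]),
    hv _ (by rwa [x.angle_act _ 2 2]), hv _ (by rwa [x.angle_act _ 2 2]), hc1, hc2, hc3,
    Flag.act_one, x.angle_act _ 1 1, x.angle_act _ 2 2, x.angle_act _ 3 3, x.angle_act _ 1 1, x.angle_act _ 2 2,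
    x.angle_act _ 3 3, x.angle_act _ 1 1, x.angle_act _ 2 2, x.angle_act _ 3 3]
  ring

theorem IsVeering.add_smul_blueMinusRed (h : T.IsVeering θ) {x : Flag ι}
    (hx : θ (x.angle 2) = Real.pi) (hev : x.IsEven) (t : ℝ) :
    (θ + t • T.blueMinusRed θ) (x.angle 1) =
        t * (2 - (T.color θ x.turn + T.color θ x.turn.opp)) ∧
      (θ + t • T.blueMinusRed θ) (x.angle 2) = Real.pi - 4 * t ∧
      (θ + t • T.blueMinusRed θ) (x.angle 3) =
        t * (2 + (T.color θ x.turn + T.color θ x.turn.opp)) := by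
  classical
  have h1 := h.angle_one_eq_zero hx
  have h3 : θ (x.angle 3) = 0 := by
    have := h.sum_angle x
    linarith
  have hne : ∀ k l : Fin 4, k ≠ 0 → l ≠ 0 → k ≠ l → x.angle k ≠ x.angle l :=
    fun k l hk hl hkl => mt (x.angle_eq_angle_iff hk hl).1 hkl
  have h12 := hne 1 2 (by decide) (by decide) (by decide)
  have h13 := hne 1 3 (by decide) (by decide) (by decide)
  have h23 := hne 2 3 (by decide) (by decide) (by decide)
  simp only [Pi.add_apply, Pi.smul_apply, smul_eq_mul]
  rw [h.blueMinusRed_apply hx hev rfl, h.blueMinusRed_apply hx hev rfl,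
    h.blueMinusRed_apply hx hev rfl, h1, hx, h3]
  simp only [h12, h13, h23, h12.symm, h13.symm, h23.symm, if_true, if_false]
  refine ⟨?_, ?_, ?_⟩ <;> ring

theorem IsVeering.exists_wide (h : T.IsVeering θ) (i : ι) :
    ∃ x : Flag ι, x.IsEven ∧ x.1 = i ∧ θ (x.angle 2) = Real.pi := by
  obtain ⟨x, hx, hxi⟩ : ∃ x : Flag ι, x.IsEven ∧ x.1 = i :=
    ⟨(i, 1), by simp [Flag.IsEven], rfl⟩
  rcases h.cases_angle x with c | c | c
  · refine ⟨x.turn.turn, Flag.isEven_turn.2 (Flag.isEven_turn.2 hx), hxi, ?_⟩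
    rw [Flag.turn_eq, Flag.turn_eq, Flag.act_act, x.angle_act _ 2 1]
    exact c.1
  · exact ⟨x, hx, hxi, c.2.1⟩
  · refine ⟨x.turn, Flag.isEven_turn.2 hx, hxi, ?_⟩
    rw [Flag.turn_eq, x.angle_act _ 2 3]
    exact c.2.2

theorem IsVeering.isPartiallyRescued (h : T.IsVeering θ) {t : ℝ}
    (ht : t ∈ Set.Ioo (0 : ℝ) (Real.pi / 4)) :
    T.IsPartiallyRescued θ (θ + t • T.blueMinusRed θ) where
  toIsGeneralizedAngleStructure :=
    h.toIsGeneralizedAngleStructure.add ((isTangent_blueMinusRed θ).smul t)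
  hinge_pos := by
    rintro i ⟨y, hy, rfl, hy1, hl, hr⟩ q
    have hx : θ (y.turn.turn.angle 2) = Real.pi := by
      rwa [Flag.turn_eq, Flag.turn_eq, Flag.act_act, y.angle_act _ 2 1]
    obtain ⟨h1, h2, h3⟩ := h.add_smul_blueMinusRed hx
      (Flag.isEven_turn.2 (Flag.isEven_turn.2 hy)) t
    rw [Flag.turn_turn_turn, color_eq_one.2 hl, color_eq_neg_one.2 (h.rightVeering_iff.1 hr)]
      at h1 h3
    rcases Flag.eq_angle (x := y.turn.turn) (j := (y.1, q)) rfl with hj | hj | hj <;> rw [hj]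
    · rw [h1]; linarith [ht.1]
    · rw [h2]; linarith [ht.2]
    · rw [h3]; linarith [ht.1]
  nonhinge_nonneg := by
    intro i _ q
    obtain ⟨x, hev, rfl, hx⟩ := h.exists_wide i
    obtain ⟨h1, h2, h3⟩ := h.add_smul_blueMinusRed hx hev t
    rcases Flag.eq_angle (x := x) (j := (x.1, q)) rfl with hj | hj | hj <;> rw [hj]
    · rw [h1]
      refine mul_nonneg ht.1.le ?_
      rcases color_cases (T := T) (θ := θ) x.turn with c | c <;>
        rcases color_cases (T := T) (θ := θ) x.turn.opp with c' | c' <;> rw [c, c'] <;> norm_num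
    · rw [h2]; linarith [ht.2]
    · rw [h3]
      refine mul_nonneg ht.1.le ?_
      rcases color_cases (T := T) (θ := θ) x.turn with c | c <;>
        rcases color_cases (T := T) (θ := θ) x.turn.opp with c' | c' <;> rw [c, c'] <;> norm_num
  zero_opposite := by
    intro y hev hy
    rcases h.cases_angle y with c | c | c
    · have h1 : y.turn.turn.angle 2 = y.angle 1 := by
        rw [Flag.turn_eq, Flag.turn_eq, Flag.act_act, y.angle_act _ 2 1]
      have h2 := (h.add_smul_blueMinusRed (h1.symm ▸ c.1)
        (Flag.isEven_turn.2 (Flag.isEven_turn.2 hev)) t).2.1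
      rw [h1, hy] at h2
      linarith [ht.2]
    · have h1 := (h.add_smul_blueMinusRed c.2.1 hev t).1
      rw [hy] at h1
      -- The colors are `1` or `-1`, so their sum is `2` only if both diagonals are left-veering.
      have h2 := (mul_eq_zero.1 h1.symm).resolve_left ht.1.ne'
      refine Or.inl ⟨color_eq_one.1 ?_, h.leftVeering_turn_turn c.2.1⟩
      rcases color_cases (T := T) (θ := θ) y.turn with c | c
      · exact c
      · rcases color_cases (T := T) (θ := θ) y.turn.opp with c' | c' <;> linarith
    · have h1 : y.turn.angle 2 = y.angle 3 := by rw [Flag.turn_eq, y.angle_act _ 2 3]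
      have h3 : y.turn.angle 3 = y.angle 1 := by rw [Flag.turn_eq, y.angle_act _ 3 1]
      have h1' : θ (y.turn.angle 2) = Real.pi := h1.symm ▸ c.2.2
      have h2 := (h.add_smul_blueMinusRed h1' (Flag.isEven_turn.2 hev) t).2.2
      rw [h3, hy] at h2
      have h4 := (mul_eq_zero.1 h2.symm).resolve_left ht.1.ne'
      refine Or.inr ⟨h.rightVeering h1', h.rightVeering_iff.2 (color_eq_neg_one.1 ?_)⟩
      rcases color_cases (T := T) (θ := θ) y.turn.turn with c | c
      · rcases color_cases (T := T) (θ := θ) y.turn.turn.opp with c' | c' <;> linarith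
      · exact c

/-! ### From the first deformation to a path of positive structures -/

theorem IsPartiallyRescued.exists_isPositive (h : T.IsVeering θ) {θ' : AngleVector ι}
    (h' : T.IsPartiallyRescued θ θ') : ∃ θ₁, T.IsPositive θ₁ := by
  by_cases h0 : ∃ j, θ' j = 0
  · obtain ⟨γ, -, -, hev⟩ := h'.exists_curve h h0
    obtain ⟨t, ht, hlt⟩ := hev.exists
    exact ht.exists_isPositive h
  · push Not at h0
    refine ⟨θ', h'.toIsGeneralizedAngleStructure, ?_⟩
    rintro ⟨i, q⟩
    by_cases hi : T.IsHinge θ i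
    · exact h'.hinge_pos i hi q
    · exact (h'.nonhinge_nonneg i hi q).lt_of_ne' (h0 _)
termination_by {j | θ' j = 0}.ncard

theorem IsPositive.convex {θ₁ : AngleVector ι} (h : T.IsTaut θ) (h₁ : T.IsPositive θ₁) {s : ℝ}
    (hs : s ∈ Set.Ioc (0 : ℝ) 1) : T.IsPositive ((1 - s) • θ + s • θ₁) where
  tetrahedron i := by
    simp only [Pi.add_apply, Pi.smul_apply, smul_eq_mul, Finset.sum_add_distrib, ← Finset.mul_sum,
      h.tetrahedron, h₁.tetrahedron]
    ring
  edge x := by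
    simp only [Pi.add_apply, Pi.smul_apply, smul_eq_mul, Finset.sum_add_distrib, ← Finset.mul_sum,
      h.edge, h₁.edge]
    ring
  pos j := by
    have h0 : 0 ≤ θ j := by
      rcases h.zero_or_pi j with h0 | h0 <;> rw [h0]
      exact Real.pi_pos.le
    have := mul_nonneg (sub_nonneg.2 hs.2) h0
    have := mul_pos hs.1 (h₁.pos j)
    simp only [Pi.add_apply, Pi.smul_apply, smul_eq_mul]
    linarith

end IdealTriangulation
end Veering
end

theorem theorem1p1 {ι : Type*} [Fintype ι] (T : Veering.IdealTriangulation ι)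
    (θ : Veering.AngleVector ι) (hθ : T.IsVeering θ) :
    -- the veering structure can be deformed to positive angle structures
    (∃ Θ : ℝ → Veering.AngleVector ι, Continuous Θ ∧ Θ 0 = θ ∧
      ∀ s ∈ Set.Ioc (0 : ℝ) 1, T.IsPositive (Θ s)) ∧
    -- the first deformation
    (∀ t ∈ Set.Ioo (0 : ℝ) (Real.pi / 4),
      T.IsPartiallyRescued θ (θ + t • T.blueMinusRed θ)) ∧
    -- removal of the remaining zeros
    (∀ θ' : Veering.AngleVector ι, T.IsPartiallyRescued θ θ' → (∃ j, θ' j = 0) →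
      ∃ γ : List (Veering.Flag ι), T.IsSimpleNormalCurve γ ∧ T.IsTrivialCurve γ ∧
        ∀ᶠ t in 𝓝[>] (0 : ℝ),
          T.IsPartiallyRescued θ (θ' + t • Veering.curveDeformation γ) ∧
          {j | (θ' + t • Veering.curveDeformation γ) j = 0}.ncard < {j | θ' j = 0}.ncard) := by
  refine ⟨?_, fun t ht => hθ.isPartiallyRescued ht, fun θ' h' h0 => h'.exists_curve hθ h0⟩
  have hpi := Real.pi_pos
  -- Any parameter in `(0, π/4)` would serve to start the removal of zeros.
  obtain ⟨θ₁, h₁⟩ := (hθ.isPartiallyRescued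
    (t := Real.pi / 8) ⟨by linarith, by linarith⟩).exists_isPositive hθ
  exact ⟨fun s => (1 - s) • θ + s • θ₁, by fun_prop, by simp, fun s hs => h₁.convex hθ.toIsTaut hs⟩
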